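/- Let $\Sigma$ be a finite alphabet with $0,1\in\Sigma$. A multi-function $f:A\rightrightarrows B$ assigns to each $a\in A$ a set $f(a)\subseteq B$; $\mathrm{dom}(f)=\{a: f(a)\neq\emptyset\}$; $f'$ extends $f$ if $\mathrm{dom}(f)\subseteq\mathrm{dom}(f')$ and $f'(x)\subseteq f(x)$ for all $x\in\mathrm{dom}(f)$. A multi-represented set is a set $Z$ with a multi-function $\delta:\Sigma^\omega\rightrightarrows Z$ whose range is $Z$; if $z\in\delta(p)$, then $p$ is called a name of $z$. A partial function $F$ on $\Sigma^\omega$ realizes $c:Z_1\times\dots\times Z_n\rightrightarrows Z_0$ if, whenever $p_1,\dots,p_n$ are names of $y_1,\dots,y_n$ and $(y_1,\dots,y_n)\in\mathrm{dom}(c)$, $F(p_1,\dots,p_n)$ exists and is a name of some element of $c(y_1,\dots,y_n)$; $c$ is computable (continuous) if it has a computable (continuous) realization, where a partial function on $\Sigma^\omega$ is computable if some Type-2 machine computes an extension of it. The same is used for partial functions into $\Sigma^*$, a word being its own name. For $f:Z_1\rightrightarrows Z_2$ and $g:Z_3\rightrightarrows Z_4$, $f\le_W g$ means that there are computable partial functions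 $G,H$ on $\Sigma^\omega$ such that for every partial function $h$ on $\Sigma^\omega$ realizing $g$, the function $p\mapsto G(p,h(H(p)))$ realizes $f$. Continuous reducibility is defined with continuous $G,H$. A generalized Turing machine (GTM) $N$ has tapes $0,\dots,L$, where tapes $1,\dots,k$ are the input tapes and tape $0$ is the output tape. Each cell of tape $i$ contains an element of a set $X_i$ or a symbol of a finite work alphabet $\Gamma$ (disjoint from $X_i$, with a blank). There are finitely many labels, among them an initial label $l_0$ and a final label $l_f$. Each label $l\ne l_f$ carries a statement: move the head of a tape one cell to the right or left; write a symbol $a\in\Gamma$; branch on whether $a\in\Gamma$ is scanned; an assignment $(i:=c(i_1,\dots,i_n),l')$ with a multi-function $c:X_{i_1}\times\dots\times X_{i_n}\rightrightarrows X_i$, which writes any element of $c(x_{i_1},\dots,x_{i_n})$, where $x_j$ is the content of the scanned cell of tape $j$; or a test $(\text{if }t(i_1,\dots,i_n)\text{ then }l'\text{ else }l'')$ with a partial function $t$ from $X_{i_1}\times\dots\times X_{i_n}$ to $\Sigma^*$ with values in $\{0,1\}$ ($0$ means "then"). Initially the inputs are in cells $0$ of the input tapes, all other cells are blank, and all heads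 are on cell $0$. A computation is accepting if it is finite and ends with label $l_f$ and an element of $X_0$ (the result) in cell $0$ of tape $0$. One has $x_0\in f_N(x)$ iff every maximal computation on input $x$ is accepting and some accepting computation on input $x$ has result $x_0$. The directed graph $\mathrm{graph}(N)$ on the labels has an edge from $l\neq l_f$ to every next label that is named in the statement of $l$. **Theorem.** Let $f:Z_1\rightrightarrows Z_2$ and $g:Z_3\rightrightarrows Z_4$ be multi-functions on multi-represented sets such that $g$ is not computable. Let $N$ be a GTM with one input tape on multi-represented sets (each $X_i$ has a multi-representation $\delta_i$; those of tapes $1$ and $0$ are $Z_1$ and $Z_2$) such that 1. every test in $N$ is computable; 2. every assignment in $N$ either uses a computable multi-function or is of the form $(i:=g(i_1),l')$, where tapes $i_1$ and $i$ carry the multi-represented sets $Z_3$ and $Z_4$; 3. every path in $\mathrm{graph}(N)$ starting at $l_0$ visits at most once a label whose statement applies $g$; 4. $f_N$ extends $f$. Suppose moreover that some element of $\mathrm{dom}(g)$ has a computable name, or that every accepting computation of $N$ on an input from $\mathrm{dom}(f)$ visits a label whose statement applies $g$. Then $f\le_W g$. Likewise, if $g$ is not continuous and the conditions hold with "continuous"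 in place of "computable" in 1 and 2, then $f$ is continuously reducible to $g$; here the additional supposition is not needed. -/

import Mathlib

universe u

namespace GTMWeihrauch

/-! ### Multi-functions -/

/-- A multi-function from `α` to `β`: to every `a` the set of all acceptable results. -/
abbrev MultiFun (α : Type*) (β : Type*) := α → Set β

/-- The domain of a multi-function. -/
def MultiFun.dom {α β : Type*} (f : MultiFun α β) : Set α := {a | (f a).Nonempty}

/-- `f'` extends `f`: `dom f ⊆ dom f'`, and `f' x ⊆ f x` for all `x ∈ dom f`. -/
def MultiFun.Extends {α β : Type*} (f' f : MultiFun α β) : Prop :=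
  f.dom ⊆ f'.dom ∧ ∀ x ∈ f.dom, f' x ⊆ f x

/-! ### Words, sequences, and the functions on them

The alphabet is `Fin (s + 2)`: an arbitrary finite alphabet containing the symbols `0` and `1`. -/

/-- Finite words over the alphabet. -/
abbrev Word (s : ℕ) := List (Fin (s + 2))

/-- Infinite sequences over the alphabet; the topology is the Cantor (product) topology. -/
abbrev Seq (s : ℕ) := ℕ → Fin (s + 2)

/-- The prefix of length `m` of an infinite sequence. -/
def Seq.pre {s : ℕ} (p : Seq s) (m : ℕ) : Word s := (List.range m).map p

/-- The tuple of the prefixes of length `m` of a tuple of sequences. -/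
def preTuple {s n : ℕ} (p : Fin n → Seq s) (m : ℕ) : Fin n → Word s := fun j => (p j).pre m

/-- An `n`-ary partial function on sequences is computable if it has an extension computed by an
effective procedure with a one-way output tape: `out m u` is the finite word that has been
written after stage `m`, when `u` consists of the first `m` symbols of every input.  Outside of
the domain of `F` nothing but monotonicity is required of the output. -/
def SeqFunComputable {s n : ℕ} (F : (Fin n → Seq s) →. Seq s) : Prop :=
  ∃ out : ℕ → (Fin n → Word s) → Word s,
    Computable₂ out ∧
    (∀ p m, out m (preTuple p m) <+: out (m + 1) (preTuple p (m + 1))) ∧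
    ∀ p, ∀ q ∈ F p,
      (∀ m, out m (preTuple p m) = q.pre (out m (preTuple p m)).length) ∧
      (∀ k, ∃ m, k ≤ (out m (preTuple p m)).length)

/-- An `n`-ary partial function from sequences to words is computable if it has an extension
computed by an effective procedure that halts with the result: `out m u = some w` means that
the procedure has halted with result `w` by stage `m`, when `u` consists of the first `m`
symbols of every input. -/
def WordFunComputable {s n : ℕ} (F : (Fin n → Seq s) →. Word s) : Prop :=
  ∃ out : ℕ → (Fin n → Word s) → Option (Word s),
    Computable₂ out ∧
    (∀ p m w, out m (preTuple p m) = some w → out (m + 1) (preTuple p (m + 1)) = some w) ∧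
    ∀ p, ∀ w ∈ F p, ∃ m, out m (preTuple p m) = some w

/-- Continuity of a partial function on sequences (on its domain, with the subspace topology). -/
def SeqFunContinuous {s n : ℕ} (F : (Fin n → Seq s) →. Seq s) : Prop :=
  Continuous F.asSubtype

/-- Continuity of a partial function from sequences to the discrete space of words. -/
def WordFunContinuous {s n : ℕ} (F : (Fin n → Seq s) →. Word s) : Prop :=
  IsLocallyConstant F.asSubtype

/-! ### Multi-represented sets, realization, computability, reducibility -/

/-- A set with a multi-representation: `x ∈ rep p` means that `p` is a name of `x`; a sequence
may be a name of several elements (or of none), and every element has a name. -/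
structure MRSet (s : ℕ) where
  carrier : Type u
  rep : Seq s → Set carrier
  surj : ∀ x, ∃ p, x ∈ rep p

instance (s : ℕ) : CoeSort (MRSet.{u} s) (Type u) := ⟨MRSet.carrier⟩

/-- A multi-function of several arguments on multi-represented sets, together with these sets. -/
structure MFun (s : ℕ) where
  arity : ℕ
  source : Fin arity → MRSet.{u} s
  target : MRSet.{u} s
  fn : MultiFun (∀ j, source j) target

/-- A multi-function of one argument as an `MFun`. -/
def unary {s : ℕ} {S T : MRSet.{u} s} (f : MultiFun S T) : MFun.{u} s where
  arity := 1
  source := fun _ => S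
  target := T
  fn := fun v => f (v 0)

/-- The partial function `F` on names realizes the multi-function `c`. -/
def MFun.RealizedBy {s : ℕ} (c : MFun.{u} s) (F : (Fin c.arity → Seq s) →. Seq s) : Prop :=
  ∀ (p : Fin c.arity → Seq s) (y : ∀ j, c.source j), (∀ j, y j ∈ (c.source j).rep (p j)) →
    y ∈ c.fn.dom → (F p).Dom ∧ ∀ q ∈ F p, ∃ z ∈ c.fn y, z ∈ c.target.rep q

/-- `c` is computable with respect to the given multi-representations. -/
def MFun.IsComputable {s : ℕ} (c : MFun.{u} s) : Prop :=
  ∃ F, SeqFunComputable F ∧ c.RealizedBy F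

/-- `c` is continuous with respect to the given multi-representations. -/
def MFun.IsContinuous {s : ℕ} (c : MFun.{u} s) : Prop :=
  ∃ F, SeqFunContinuous F ∧ c.RealizedBy F

/-- The partial function `F` realizes the word-valued partial function `t`, where words are
represented by themselves. -/
def TestRealizedBy {s n : ℕ} (S : Fin n → MRSet.{u} s) (t : (∀ j, S j) →. Word s)
    (F : (Fin n → Seq s) →. Word s) : Prop :=
  ∀ (p : Fin n → Seq s) (y : ∀ j, S j), (∀ j, y j ∈ (S j).rep (p j)) → ∀ w ∈ t y, w ∈ F p

/-- `t` is computable with respect to the given multi-representations. -/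
def TestComputable {s n : ℕ} (S : Fin n → MRSet.{u} s) (t : (∀ j, S j) →. Word s) : Prop :=
  ∃ F, WordFunComputable F ∧ TestRealizedBy S t F

/-- `t` is continuous with respect to the given multi-representations. -/
def TestContinuous {s n : ℕ} (S : Fin n → MRSet.{u} s) (t : (∀ j, S j) →. Word s) : Prop :=
  ∃ F, WordFunContinuous F ∧ TestRealizedBy S t F

/-- The partial function `p ↦ G (p, h (H p))` on sequences. -/
def reductionFun {s : ℕ} (G : (Fin 2 → Seq s) →. Seq s) (H h : (Fin 1 → Seq s) →. Seq s) :
    (Fin 1 → Seq s) →. Seq s :=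
  fun p => (H p).bind fun q => (h ![q]).bind fun r => G ![p 0, r]

/-- `G` and `H` reduce `f` to `g`: for every partial function `h` realizing `g`, the function
`p ↦ G (p, h (H p))` realizes `f`. -/
def IsReduction {s : ℕ} {S₁ S₂ S₃ S₄ : MRSet.{u} s} (G : (Fin 2 → Seq s) →. Seq s)
    (H : (Fin 1 → Seq s) →. Seq s) (f : MultiFun S₁ S₂) (g : MultiFun S₃ S₄) : Prop :=
  ∀ h : (Fin 1 → Seq s) →. Seq s,
    (unary g).RealizedBy h → (unary f).RealizedBy (reductionFun G H h)

/-- Weihrauch reducibility `f ≤_W g`. -/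
def WeihrauchLE {s : ℕ} {S₁ S₂ S₃ S₄ : MRSet.{u} s} (f : MultiFun S₁ S₂) (g : MultiFun S₃ S₄) :
    Prop :=
  ∃ G H, SeqFunComputable G ∧ SeqFunComputable H ∧ IsReduction G H f g

/-- Continuous Weihrauch reducibility. -/
def ContWeihrauchLE {s : ℕ} {S₁ S₂ S₃ S₄ : MRSet.{u} s} (f : MultiFun S₁ S₂)
    (g : MultiFun S₃ S₄) : Prop :=
  ∃ G H, SeqFunContinuous G ∧ SeqFunContinuous H ∧ IsReduction G H f g

/-! ### Generalized Turing machines -/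

/-- The statements of a generalized Turing machine with tapes `0, …, L`, where `X i` is the set
of tape `i`, `Γ` is the work alphabet and `Λ` is the set of labels. -/
inductive Stmt (s : ℕ) {L : ℕ} (X : Fin (L + 1) → Type u) (Γ Λ : Type) : Type u
  /-- Move the head of tape `i` one cell to the right. -/
  | right (i : Fin (L + 1)) (l : Λ)
  /-- Move the head of tape `i` one cell to the left. -/
  | left (i : Fin (L + 1)) (l : Λ)
  /-- Write the symbol `a` on tape `i`. -/
  | write (i : Fin (L + 1)) (a : Γ) (l : Λ)
  /-- Branch on whether the symbol `a` is scanned on tape `i`. -/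
  | ifSymbol (i : Fin (L + 1)) (a : Γ) (l l' : Λ)
  /-- `(i := c(i₁, …, iₙ), l)` for a multi-function `c`. -/
  | assign (i : Fin (L + 1)) {n : ℕ} (src : Fin n → Fin (L + 1))
      (c : MultiFun (∀ j, X (src j)) (X i)) (l : Λ)
  /-- `(if t(i₁, …, iₙ) then l, else l')` for a partial word function `t` with values in
  `{0, 1}`. -/
  | test {n : ℕ} (src : Fin n → Fin (L + 1)) (t : (∀ j, X (src j)) →. Word s)
      (range_subset : ∀ v, ∀ w ∈ t v, w = [0] ∨ w = [1]) (l l' : Λ)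

/-- The possible next labels of a statement. -/
def Stmt.targets {s L : ℕ} {X : Fin (L + 1) → Type u} {Γ Λ : Type} : Stmt s X Γ Λ → Set Λ
  | .right _ l => {l}
  | .left _ l => {l}
  | .write _ _ l => {l}
  | .ifSymbol _ _ l l' => {l, l'}
  | .assign _ _ _ l => {l}
  | .test _ _ _ l l' => {l, l'}

/-- A generalized Turing machine with tapes `0, …, L`. -/
structure GTM (s : ℕ) {L : ℕ} (X : Fin (L + 1) → Type u) where
  /-- The labels. -/
  Label : Type
  finite_label : Finite Label
  start : Label
  final : Label
  /-- The work alphabet. -/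
  Γ : Type
  finite_Γ : Finite Γ
  blank : Γ
  /-- The number of input tapes; these are the tapes `1, …, k`. -/
  k : ℕ
  k_le : k ≤ L
  stm : (l : Label) → l ≠ final → Stmt s X Γ Label

namespace GTM

variable {s L : ℕ} {X : Fin (L + 1) → Type u}

/-- The `j`-th input tape; counting from `j = 0`, this is tape `j + 1`. -/
def inputTape (N : GTM s X) (j : Fin N.k) : Fin (L + 1) := (Fin.castLE N.k_le j).succ

/-- A configuration: a label, the inscriptions of the tapes and the positions of the heads. -/
structure Config (N : GTM s X) where
  label : N.Label
  tape : ∀ i, ℤ → X i ⊕ N.Γ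
  head : Fin (L + 1) → ℤ

variable {N : GTM s X}

/-- The content of the cell scanned on tape `i`. -/
def Config.scan (κ : N.Config) (i : Fin (L + 1)) : X i ⊕ N.Γ := κ.tape i (κ.head i)

/-- Replace the label. -/
def Config.goto (κ : N.Config) (l : N.Label) : N.Config := { κ with label := l }

/-- Move the head of tape `i` by `d` cells. -/
def Config.move (κ : N.Config) (i : Fin (L + 1)) (d : ℤ) : N.Config :=
  { κ with head := Function.update κ.head i (κ.head i + d) }

/-- Write `x` on the cell scanned on tape `i`. -/
def Config.put (κ : N.Config) (i : Fin (L + 1)) (x : X i ⊕ N.Γ) : N.Config :=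
  { κ with tape := Function.update κ.tape i (Function.update (κ.tape i) (κ.head i) x) }

/-- `κ'` is a possible result of executing a statement in configuration `κ`. -/
def Exec (κ κ' : N.Config) : Stmt s X N.Γ N.Label → Prop
  | .right i l => κ' = (κ.move i 1).goto l
  | .left i l => κ' = (κ.move i (-1)).goto l
  | .write i a l => κ' = (κ.put i (Sum.inr a)).goto l
  | .ifSymbol i a l l' =>
      (κ.scan i = Sum.inr a ∧ κ' = κ.goto l) ∨ (κ.scan i ≠ Sum.inr a ∧ κ' = κ.goto l')
  | .assign i src c l =>
      ∃ v : ∀ j, X (src j), (∀ j, κ.scan (src j) = Sum.inl (v j)) ∧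
        ∃ x ∈ c v, κ' = (κ.put i (Sum.inl x)).goto l
  | .test src t _ l l' =>
      ∃ v : ∀ j, X (src j), (∀ j, κ.scan (src j) = Sum.inl (v j)) ∧
        (([0] ∈ t v ∧ κ' = κ.goto l) ∨ ([1] ∈ t v ∧ κ' = κ.goto l'))

/-- The successor relation on configurations. -/
def Step (κ κ' : N.Config) : Prop :=
  ∃ h : κ.label ≠ N.final, Exec κ κ' (N.stm κ.label h)

variable (N)

/-- The initial configuration: `x j` is in cell `0` of the `j`-th input tape, all other cells are
blank, and all heads are on position `0`. -/
def init (x : ∀ j : Fin N.k, X (N.inputTape j)) : N.Config where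
  label := N.start
  tape := Fin.cases (fun _ => Sum.inr N.blank)
    (fun j m => if h : m = 0 ∧ j.val < N.k then Sum.inl (x ⟨j.val, h.2⟩) else Sum.inr N.blank)
  head := fun _ => 0

variable {N}

/-- `x` is the result of the accepting configuration `κ`: the label is final and `x` is in cell
`0` of the output tape. -/
def Config.Accepts (κ : N.Config) (x : X 0) : Prop :=
  κ.label = N.final ∧ κ.tape 0 0 = Sum.inl x

/-- `c 0, …, c n` is a (finite) computation with first configuration `κ`. -/
def FinComputation (κ : N.Config) (c : ℕ → N.Config) (n : ℕ) : Prop :=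
  c 0 = κ ∧ ∀ i < n, Step (c i) (c (i + 1))

/-- `c 0, c 1, …` is an infinite computation with first configuration `κ`. -/
def InfComputation (κ : N.Config) (c : ℕ → N.Config) : Prop :=
  c 0 = κ ∧ ∀ i, Step (c i) (c (i + 1))

variable (N)

/-- The multi-function `f_N` computed by `N`: `x₀ ∈ f_N x` iff every maximal computation on
input `x` is (finite and) accepting, and there is an accepting computation with result `x₀`. -/
def compute : MultiFun (∀ j : Fin N.k, X (N.inputTape j)) (X 0) := fun x => {x₀ |
  ((¬ ∃ c, InfComputation (N.init x) c) ∧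
    ∀ c n, FinComputation (N.init x) c n → (∀ κ, ¬ Step (c n) κ) → ∃ y, (c n).Accepts y) ∧
  ∃ c n, FinComputation (N.init x) c n ∧ (c n).Accepts x₀}

/-- The edges of `graph(N)`. -/
def Edge (l l' : N.Label) : Prop := ∃ h : l ≠ N.final, l' ∈ (N.stm l h).targets

/-- `π 0, …, π n` is a path in `graph(N)` that starts at the initial label. -/
def IsPath (π : ℕ → N.Label) (n : ℕ) : Prop :=
  π 0 = N.start ∧ ∀ i < n, N.Edge (π i) (π (i + 1))

end GTM

/-! ### Machines on multi-represented sets -/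

section OnMRSets

variable {s L : ℕ} {Z : Fin (L + 1) → MRSet.{u} s}

/-- The statement is `(i := g(i₁), l')`; that is, it is an assignment whose multi-function,
together with the multi-represented sets of the tapes involved, is `g`. -/
def Stmt.Applies {Γ Λ : Type} {S₃ S₄ : MRSet.{u} s} (g : MultiFun S₃ S₄) :
    Stmt s (fun i => (Z i).carrier) Γ Λ → Prop
  | .assign i src c _ => (⟨_, fun j => Z (src j), Z i, c⟩ : MFun.{u} s) = unary g
  | _ => False

/-- Assignments use only multi-functions with the property `P`. -/
def Stmt.AssignSat {Γ Λ : Type} (P : MFun.{u} s → Prop) :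
    Stmt s (fun i => (Z i).carrier) Γ Λ → Prop
  | .assign i src c _ => P ⟨_, fun j => Z (src j), Z i, c⟩
  | _ => True

/-- Tests use only partial functions with the property `P`. -/
def Stmt.TestSat {Γ Λ : Type}
    (P : ∀ {n : ℕ} (S : Fin n → MRSet.{u} s), ((∀ j, S j) →. Word s) → Prop) :
    Stmt s (fun i => (Z i).carrier) Γ Λ → Prop
  | .test src t _ _ _ => P (fun j => Z (src j)) t
  | _ => True

variable (N : GTM s (fun i => (Z i).carrier)) {S₃ S₄ : MRSet.{u} s} (g : MultiFun S₃ S₄)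

/-- The label `l` applies `g`. -/
def GTM.LabelApplies (l : N.Label) : Prop := ∃ h : l ≠ N.final, (N.stm l h).Applies g

/-- Every path in `graph(N)` from the initial label visits at most once a label applying `g`. -/
def GTM.AppliesAtMostOnce : Prop :=
  ∀ π n, N.IsPath π n → ∀ i ≤ n, ∀ j ≤ n,
    N.LabelApplies g (π i) → N.LabelApplies g (π j) → i = j

/-- Every accepting computation on an input from `D` visits a label applying `g`. -/
def GTM.AlwaysApplies (D : Set (∀ j : Fin N.k, Z (N.inputTape j))) : Prop :=
  ∀ x ∈ D, ∀ c n, GTM.FinComputation (N.init x) c n → (∃ y, (c n).Accepts y) →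
    ∃ i ≤ n, N.LabelApplies g (c i).label

/-- Every test in `N` is computable. -/
def GTM.TestsComputable : Prop := ∀ l h, (N.stm l h).TestSat TestComputable

/-- Every test in `N` is continuous. -/
def GTM.TestsContinuous : Prop := ∀ l h, (N.stm l h).TestSat TestContinuous

/-- Every assignment in `N` is computable or applies `g`. -/
def GTM.AssignsComputableOr : Prop :=
  ∀ l h, (N.stm l h).AssignSat MFun.IsComputable ∨ (N.stm l h).Applies g

/-- Every assignment in `N` is continuous or applies `g`. -/
def GTM.AssignsContinuousOr : Prop :=
  ∀ l h, (N.stm l h).AssignSat MFun.IsContinuous ∨ (N.stm l h).Applies g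

/-- Some element of `dom g` has a computable name. -/
def HasComputablePoint : Prop := ∃ y ∈ g.dom, ∃ p : Seq s, Computable p ∧ y ∈ S₃.rep p

end OnMRSets

end GTMWeihrauch

/-!
A run of `N` on names is simulated on their finite prefixes: computable (continuous) assignments and
tests are replaced by monotone procedures on prefixes, so that the words on the tapes converge to
names of the contents of the cells of a run of `N`.  No prefix of a name of the input tells whether
`g` will be applied, so the simulation waits when it reaches a label applying `g`; the word to which
`g` is applied is then the question computed by `H`.  Given the answer of a realizer of `g`, the
simulation resumes, and since no path in the graph of `N` visits a second label applying `g`, it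
reaches the final label without another question: this is `G`.  A run that ends without applying `g`
still has to ask a question to which every realizer of `g` has an answer, and for this a fixed name
of an element of `dom g` is used.
-/

namespace GTMWeihrauch

open Filter Topology

/-! ### Prefixes and convergence -/

section Prefixes

variable {s n : ℕ}

@[simp]
theorem Seq.length_pre (p : Seq s) (m : ℕ) : (p.pre m).length = m := by
  simp [Seq.pre]

theorem Seq.take_pre (p : Seq s) (k m : ℕ) : (p.pre m).take k = p.pre (min k m) := by
  simp [Seq.pre, ← List.map_take, List.take_range]

theorem Seq.pre_succ (p : Seq s) (m : ℕ) : p.pre (m + 1) = p.pre m ++ [p m] := by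
  simp [Seq.pre, List.range_succ]

theorem Seq.pre_eq_pre_iff {p q : Seq s} {m : ℕ} : p.pre m = q.pre m ↔ ∀ i < m, p i = q i := by
  simp [Seq.pre]

theorem Seq.pre_prefix_pre (p : Seq s) {k m : ℕ} (h : k ≤ m) : p.pre k <+: p.pre m := by
  simpa only [Seq.take_pre, min_eq_left h] using List.take_prefix k (p.pre m)

theorem Seq.eq_pre_length_of_prefix {p : Seq s} {w : Word s} {m : ℕ} (h : w <+: p.pre m) :
    w = p.pre w.length := by
  have hw := List.prefix_iff_eq_take.1 h
  rwa [Seq.take_pre, min_eq_left (by simpa using h.length_le)] at hw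

theorem take_preTuple (p : Fin n → Seq s) {k m : ℕ} (h : k ≤ m) :
    (fun j => (preTuple p m j).take k) = preTuple p k := by
  funext j
  rw [preTuple, Seq.take_pre, min_eq_left h, preTuple]

theorem preTuple_eq_preTuple_iff {p q : Fin n → Seq s} {m : ℕ} :
    preTuple p m = preTuple q m ↔ ∀ j, ∀ i < m, p j i = q j i := by
  simp only [funext_iff, preTuple, Seq.pre_eq_pre_iff]

theorem preTuple_eq_preTuple_of_le {p q : Fin n → Seq s} {k m : ℕ} (hk : k ≤ m)
    (h : preTuple p m = preTuple q m) : preTuple p k = preTuple q k := by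
  rw [← take_preTuple p hk, h, take_preTuple q hk]

/-- The infinite sequence that continues a word by zeros. -/
def Word.toSeq (w : Word s) : Seq s := fun i => w.getD i 0

theorem Word.pre_toSeq (w : Word s) : (Word.toSeq w).pre w.length = w :=
  List.ext_getElem (by simp) fun i _ h => by simp [Seq.pre, Word.toSeq, h]

/-- Convergence of a sequence of words to an infinite sequence: every prefix of the limit is
eventually a prefix of the words. -/
def ConvergesTo (w : ℕ → Word s) (q : Seq s) : Prop :=
  ∀ k, ∀ᶠ m in atTop, q.pre k <+: w m

theorem convergesTo_pre (q : Seq s) : ConvergesTo q.pre q := fun k =>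
  (eventually_ge_atTop k).mono fun _ => q.pre_prefix_pre

theorem ConvergesTo.congr {w w' : ℕ → Word s} {q : Seq s} (h : ConvergesTo w q)
    (hw : ∀ᶠ m in atTop, w m = w' m) : ConvergesTo w' q := fun k => by
  filter_upwards [h k, hw] with m hk hm
  rwa [← hm]

theorem ConvergesTo.unique {w : ℕ → Word s} {q q' : Seq s} (h : ConvergesTo w q)
    (h' : ConvergesTo w q') : q = q' := by
  funext k
  obtain ⟨m, hq, hq'⟩ := ((h (k + 1)).and (h' (k + 1))).exists
  have hpre : q.pre (k + 1) = q'.pre (k + 1) :=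
    (List.prefix_of_prefix_length_le hq hq' (by simp)).eq_of_length (by simp)
  exact Seq.pre_eq_pre_iff.1 hpre k k.lt_succ_self

end Prefixes

/-! ### Procedures on prefixes -/

section Procedures

variable {s n : ℕ} {α : Type*}

/-- The procedure `out`, which is given the prefixes of length `m` of its arguments in stage `m`,
is monotone with respect to the relation `r`: along any arguments, its successive outputs are
related by `r`. -/
def IsMono (r : α → α → Prop) (out : ℕ → (Fin n → Word s) → α) : Prop :=
  ∀ p m, r (out m (preTuple p m)) (out (m + 1) (preTuple p (m + 1)))

/-- The information order on optional values: `none` lies below everything, and distinct values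
are incomparable. -/
def OptLe (o o' : Option α) : Prop := ∀ a, o = some a → o' = some a

instance : Std.Refl (OptLe (α := α)) := ⟨fun _ _ h => h⟩

instance : IsTrans (Option α) OptLe := ⟨fun _ _ _ h h' a ha => h' a (h a ha)⟩

/-- The monotone procedure `out`, whose outputs are prefixes of the value, computes an extension
of the sequence-valued partial function `F`. -/
def ComputesSeq (out : ℕ → (Fin n → Word s) → Word s) (F : (Fin n → Seq s) →. Seq s) : Prop :=
  IsMono (· <+: ·) out ∧ ∀ p, ∀ q ∈ F p,
    (∀ m, out m (preTuple p m) = q.pre (out m (preTuple p m)).length) ∧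
    ∀ k, ∃ m, k ≤ (out m (preTuple p m)).length

/-- The monotone procedure `out`, which outputs a value at once or not at all, computes an
extension of the partial function `F` into a discrete space. -/
def ComputesValue (out : ℕ → (Fin n → Word s) → Option α) (F : (Fin n → Seq s) →. α) : Prop :=
  IsMono OptLe out ∧ ∀ p, ∀ a ∈ F p, ∃ m, out m (preTuple p m) = some a

theorem IsMono.rel_of_le {r : α → α → Prop} [Std.Refl r] [IsTrans α r]
    {out : ℕ → (Fin n → Word s) → α} (h : IsMono r out) (p : Fin n → Seq s) {k m : ℕ}
    (hkm : k ≤ m) : r (out k (preTuple p k)) (out m (preTuple p m)) :=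
  Nat.rel_of_forall_rel_succ_of_le r (f := fun m => out m (preTuple p m)) (h p) hkm

theorem ComputesValue.eq_of_eq_some {out : ℕ → (Fin n → Word s) → Option α}
    {F : (Fin n → Seq s) →. α} (h : ComputesValue out F) {p : Fin n → Seq s} {a b : α}
    (ha : a ∈ F p) {m : ℕ} (hb : out m (preTuple p m) = some b) : b = a := by
  obtain ⟨k, hk⟩ := h.2 p a ha
  have ha' := h.1.rel_of_le p (le_max_right m k) a hk
  have hb' := h.1.rel_of_le p (le_max_left m k) b hb
  exact Option.some_injective _ (hb'.symm.trans ha')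

theorem ComputesSeq.exists_pre_prefix {out : ℕ → (Fin n → Word s) → Word s}
    {F : (Fin n → Seq s) →. Seq s} (h : ComputesSeq out F) {p : Fin n → Seq s} {q : Seq s}
    (hq : q ∈ F p) (k : ℕ) : ∃ m, q.pre k <+: out m (preTuple p m) := by
  obtain ⟨hpre, hlen⟩ := h.2 p q hq
  obtain ⟨m, hm⟩ := hlen k
  exact ⟨m, hpre m ▸ q.pre_prefix_pre hm⟩

/-- The partial function whose value is the limit of the outputs of the procedure `out`. -/
noncomputable def limFun (out : ℕ → (Fin n → Word s) → Word s) : (Fin n → Seq s) →. Seq s :=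
  fun p => ⟨∃ q, ConvergesTo (fun m => out m (preTuple p m)) q, Exists.choose⟩

theorem mem_limFun {out : ℕ → (Fin n → Word s) → Word s} {p : Fin n → Seq s} {q : Seq s} :
    q ∈ limFun out p ↔ ConvergesTo (fun m => out m (preTuple p m)) q := by
  refine ⟨?_, fun h => ⟨⟨q, h⟩, (Exists.choose_spec ⟨q, h⟩ : ConvergesTo _ _).unique h⟩⟩
  rintro ⟨h, rfl⟩
  exact h.choose_spec

theorem computesSeq_limFun {out : ℕ → (Fin n → Word s) → Word s} (h : IsMono (· <+: ·) out) :
    ComputesSeq out (limFun out) := by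
  refine ⟨h, fun p q hq => ?_⟩
  rw [mem_limFun] at hq
  refine ⟨fun m => ?_, fun k => ?_⟩
  · obtain ⟨m', hpre, hm⟩ :=
      ((hq (out m (preTuple p m)).length).and (eventually_ge_atTop m)).exists
    exact (List.prefix_of_prefix_length_le (h.rel_of_le p hm) hpre (by simp)).eq_of_length
      (by simp)
  · obtain ⟨m, hm⟩ := (hq k).exists
    exact ⟨m, by simpa using hm.length_le⟩

end Procedures

/-! ### Continuity and procedures -/

section Continuity

variable {s n : ℕ} {α : Type*}

theorem nhds_hasBasis_preTuple (p : Fin n → Seq s) :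
    (𝓝 p).HasBasis (fun _ => True) fun m => {p' | preTuple p' m = preTuple p m} := by
  have hnhds : 𝓝 p = ⨅ m, 𝓟 {p' | preTuple p' m = preTuple p m} := by
    simp only [nhds_pi, Filter.pi, nhds_discrete, comap_iInf, comap_pure, comap_principal]
    refine le_antisymm (le_iInf fun m => ?_) (le_iInf fun j => le_iInf fun i => ?_)
    · simp only [preTuple_eq_preTuple_iff, Set.ofPred_forall, le_principal_iff]
      exact iInter_mem.2 fun j => (biInter_mem (Set.finite_lt_nat m)).2 fun i _ =>
        mem_iInf_of_mem j (mem_iInf_of_mem i (mem_principal_self _))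
    · refine (iInf_le _ (i + 1)).trans (principal_mono.2 fun p' hp' => ?_)
      exact preTuple_eq_preTuple_iff.1 hp' j i i.lt_succ_self
  rw [hnhds]
  refine hasBasis_iInf_principal (directed_of_isDirected_le fun k m hkm p' => ?_)
  exact preTuple_eq_preTuple_of_le hkm

theorem ComputesSeq.seqFunContinuous {out : ℕ → (Fin n → Word s) → Word s}
    {F : (Fin n → Seq s) →. Seq s} (h : ComputesSeq out F) : SeqFunContinuous F := by
  refine continuous_pi fun i => ((IsLocallyConstant.iff_eventually_eq _).2 fun p => ?_).continuous
  have hF (x : F.Dom) : F.asSubtype x ∈ F x.1 := Part.get_mem _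
  obtain ⟨m, hm⟩ := (h.2 p.1 _ (hF p)).2 (i + 1)
  filter_upwards [(continuous_subtype_val.tendsto p).eventually
    ((nhds_hasBasis_preTuple p.1).mem_of_mem (i := m) trivial)] with p' hp'
  have hpre' := (h.2 p'.1 _ (hF p')).1 m
  rw [show preTuple p'.1 m = preTuple p.1 m from hp'] at hpre'
  exact Seq.pre_eq_pre_iff.1 (hpre'.symm.trans ((h.2 p.1 _ (hF p)).1 m)) i hm

open Classical in
/-- The value that `F` has at all arguments whose prefixes of length `m` are `u`, if there is
only one. -/
noncomputable def forcedValue (F : (Fin n → Seq s) →. α) (m : ℕ) (u : Fin n → Word s) :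
    Option α :=
  if h : ∃ a, ∀ p, preTuple p m = u → ∀ b ∈ F p, b = a then some h.choose else none

/-- The procedure that outputs the first value that is forced by prefixes of its arguments. -/
noncomputable def firstForcedValue (F : (Fin n → Seq s) →. α) :
    ℕ → (Fin n → Word s) → Option α
  | 0, _ => none
  | m + 1, u =>
    let u' := fun j => (u j).take m
    (firstForcedValue F m u').or (forcedValue F m u')

theorem eq_of_forcedValue_eq_some {F : (Fin n → Seq s) →. α} {p : Fin n → Seq s} {a b : α}
    {m : ℕ} (ha : a ∈ F p) (hb : forcedValue F m (preTuple p m) = some b) : b = a := by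
  unfold forcedValue at hb
  split_ifs at hb with h
  exact Option.some_injective _ (hb.symm.trans (congrArg some (h.choose_spec p rfl a ha).symm))

theorem exists_forcedValue_eq_some {F : (Fin n → Seq s) →. α}
    (hF : IsLocallyConstant F.asSubtype) (p : F.Dom) :
    ∃ m a, forcedValue F m (preTuple p.1 m) = some a := by
  have hev := (IsLocallyConstant.iff_eventually_eq _).1 hF p
  rw [nhds_subtype_eq_comap] at hev
  obtain ⟨m, -, hm⟩ := ((nhds_hasBasis_preTuple p.1).comap Subtype.val).eventually_iff.1 hev
  have hex : ∃ a, ∀ p', preTuple p' m = preTuple p.1 m → ∀ b ∈ F p', b = a := by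
    refine ⟨F.asSubtype p, fun p' hp' b hb => ?_⟩
    rw [← hm (x := ⟨p', Part.dom_iff_mem.2 ⟨b, hb⟩⟩) hp']
    exact Part.mem_unique hb (Part.get_mem _)
  exact ⟨m, _, dif_pos hex⟩

theorem firstForcedValue_succ_preTuple (F : (Fin n → Seq s) →. α) (p : Fin n → Seq s) (m : ℕ) :
    firstForcedValue F (m + 1) (preTuple p (m + 1)) =
      (firstForcedValue F m (preTuple p m)).or (forcedValue F m (preTuple p m)) := by
  rw [firstForcedValue, take_preTuple p m.le_succ]

theorem eq_of_firstForcedValue_eq_some {F : (Fin n → Seq s) →. α} {p : Fin n → Seq s} {a b : α}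
    {m : ℕ} (ha : a ∈ F p) (hb : firstForcedValue F m (preTuple p m) = some b) : b = a := by
  induction m with
  | zero => cases hb
  | succ m ih =>
    rw [firstForcedValue_succ_preTuple, Option.or_eq_some_iff] at hb
    exact hb.elim ih fun hb => eq_of_forcedValue_eq_some ha hb.2

theorem computesValue_firstForcedValue {F : (Fin n → Seq s) →. α}
    (hF : IsLocallyConstant F.asSubtype) : ComputesValue (firstForcedValue F) F := by
  refine ⟨fun p m a ha => ?_, fun p a ha => ?_⟩
  · rw [firstForcedValue_succ_preTuple, ha, Option.some_or]
  · obtain ⟨m, b, hm⟩ := exists_forcedValue_eq_some hF ⟨p, Part.dom_iff_mem.2 ⟨a, ha⟩⟩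
    have hsome : (firstForcedValue F (m + 1) (preTuple p (m + 1))).isSome := by
      simp [firstForcedValue_succ_preTuple, hm]
    obtain ⟨c, hc⟩ := Option.isSome_iff_exists.1 hsome
    exact ⟨m + 1, eq_of_firstForcedValue_eq_some ha hc ▸ hc⟩

/-- The procedure that collects the symbols of its output one after the other, the `k`-th symbol
being computed by the procedure `d k`. -/
def collect (d : ℕ → ℕ → (Fin n → Word s) → Option (Fin (s + 2))) :
    ℕ → (Fin n → Word s) → Word s
  | 0, _ => []
  | m + 1, u =>
    let w := collect d m fun j => (u j).take m
    w ++ (d w.length (m + 1) u).toList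

theorem collect_succ_preTuple (d : ℕ → ℕ → (Fin n → Word s) → Option (Fin (s + 2)))
    (p : Fin n → Seq s) (m : ℕ) :
    collect d (m + 1) (preTuple p (m + 1)) = collect d m (preTuple p m) ++
      (d (collect d m (preTuple p m)).length (m + 1) (preTuple p (m + 1))).toList := by
  rw [collect, take_preTuple p m.le_succ]

theorem isMono_collect (d : ℕ → ℕ → (Fin n → Word s) → Option (Fin (s + 2))) :
    IsMono (· <+: ·) (collect d) := fun p m => by
  simp only [collect_succ_preTuple, List.prefix_append]

theorem collect_eq_pre_length {d : ℕ → ℕ → (Fin n → Word s) → Option (Fin (s + 2))}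
    {F : (Fin n → Seq s) →. Seq s} (h : ∀ k, ComputesValue (d k) fun p => (F p).map (· k))
    {p : Fin n → Seq s} {q : Seq s} (hq : q ∈ F p) (m : ℕ) :
    collect d m (preTuple p m) = q.pre (collect d m (preTuple p m)).length := by
  induction m with
  | zero => simp [collect, Seq.pre]
  | succ m ih =>
    rw [collect_succ_preTuple]
    rcases ho : d (collect d m (preTuple p m)).length (m + 1) (preTuple p (m + 1)) with - | a
    · simpa using ih
    · obtain rfl := (h _).eq_of_eq_some (Part.mem_map (· (collect d m (preTuple p m)).length) hq) ho
      rw [Option.toList_some, List.length_append, List.length_singleton, Seq.pre_succ, ← ih]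

theorem exists_le_length_collect {d : ℕ → ℕ → (Fin n → Word s) → Option (Fin (s + 2))}
    {F : (Fin n → Seq s) →. Seq s} (h : ∀ k, ComputesValue (d k) fun p => (F p).map (· k))
    {p : Fin n → Seq s} {q : Seq s} (hq : q ∈ F p) (k : ℕ) :
    ∃ m, k ≤ (collect d m (preTuple p m)).length := by
  induction k with
  | zero => exact ⟨0, Nat.zero_le _⟩
  | succ k ih =>
    obtain ⟨m, hm⟩ := ih
    obtain ⟨m', hm'⟩ := (h k).2 p (q k) (Part.mem_map (· k) hq)
    have hlen : k ≤ (collect d (max m m') (preTuple p (max m m'))).length :=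
      hm.trans ((isMono_collect d).rel_of_le p (le_max_left m m')).length_le
    have hsome := (h k).1.rel_of_le p ((le_max_right m m').trans (Nat.le_succ _)) _ hm'
    refine ⟨max m m' + 1, ?_⟩
    rw [collect_succ_preTuple, List.length_append]
    rcases hlen.eq_or_lt with heq | hlt
    · rw [← heq, hsome, Option.toList_some, List.length_singleton]
    · exact hlt.trans_le (Nat.le_add_right _ _)

theorem SeqFunContinuous.exists_computesSeq {F : (Fin n → Seq s) →. Seq s}
    (hF : SeqFunContinuous F) : ∃ out, ComputesSeq out F := by
  have hcoord (k : ℕ) : ComputesValue (firstForcedValue fun p => (F p).map (· k)) fun p =>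
      (F p).map (· k) :=
    computesValue_firstForcedValue
      ((IsLocallyConstant.iff_continuous _).2 ((continuous_apply k).comp hF))
  exact ⟨_, isMono_collect _, fun p q hq =>
    ⟨collect_eq_pre_length hcoord hq, exists_le_length_collect hcoord hq⟩⟩

end Continuity

/-! ### Procedures on words of different lengths -/

section Level

variable {s n : ℕ} {α : Type*}

/-- The least of `m` and the lengths of the words `ws j`. -/
def level (m : ℕ) (ws : Fin n → Word s) : ℕ :=
  (List.ofFn ws).foldr (fun w k => min w.length k) m

/-- The output of the procedure `out` in the last stage, up to stage `m`, for which the words `ws`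
are long enough. -/
def evalAt (out : ℕ → (Fin n → Word s) → α) (m : ℕ) (ws : Fin n → Word s) : α :=
  out (level m ws) fun j => (ws j).take (level m ws)

theorem le_level_iff {k m : ℕ} {ws : Fin n → Word s} :
    k ≤ level m ws ↔ k ≤ m ∧ ∀ j, k ≤ (ws j).length := by
  have hfold (l : List (Word s)) : k ≤ l.foldr (fun w k => min w.length k) m ↔
      k ≤ m ∧ ∀ w ∈ l, k ≤ w.length := by
    induction l with
    | nil => simp
    | cons w l ih =>
      simp only [List.foldr_cons, le_min_iff, ih, List.mem_cons, forall_eq_or_imp]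
      tauto
  simp [level, hfold]

theorem evalAt_eq_out {out : ℕ → (Fin n → Word s) → α} {m k : ℕ} {ws : Fin n → Word s}
    {p : Fin n → Seq s} (hlevel : level m ws = k) (h : ∀ j, ws j = (p j).pre (ws j).length) :
    evalAt out m ws = out k (preTuple p k) := by
  subst hlevel
  unfold evalAt
  congr 1
  funext j
  conv_lhs => rw [h j]
  rw [Seq.take_pre, min_eq_left ((le_level_iff.1 le_rfl).2 j), preTuple]

theorem evalAt_preTuple (out : ℕ → (Fin n → Word s) → α) (m : ℕ) (p : Fin n → Seq s) :
    evalAt out m (preTuple p m) = out m (preTuple p m) := by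
  refine evalAt_eq_out (le_antisymm (le_level_iff.1 le_rfl).1 ?_) fun j => by
    rw [preTuple, Seq.length_pre]
  exact le_level_iff.2 ⟨le_rfl, fun j => by rw [preTuple, Seq.length_pre]⟩

theorem IsMono.rel_evalAt {r : α → α → Prop} [Std.Refl r] [IsTrans α r]
    {out : ℕ → (Fin n → Word s) → α} (h : IsMono r out) {m m' : ℕ} (hm : m ≤ m')
    {ws ws' : Fin n → Word s} (hws : ∀ j, ws j <+: ws' j) :
    r (evalAt out m ws) (evalAt out m' ws') := by
  have hlevel := le_level_iff.1 (le_refl (level m ws))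
  have hle : level m ws ≤ level m' ws' :=
    le_level_iff.2 ⟨hlevel.1.trans hm, fun j => (hlevel.2 j).trans (hws j).length_le⟩
  rw [evalAt_eq_out (ws := ws') (p := fun j => Word.toSeq (ws' j)) rfl fun j =>
      (Word.pre_toSeq _).symm,
    evalAt_eq_out (ws := ws) (p := fun j => Word.toSeq (ws' j)) rfl fun j =>
      Seq.eq_pre_length_of_prefix (Word.pre_toSeq (ws' j) ▸ hws j)]
  exact h.rel_of_le _ hle

theorem IsMono.eventually_rel_evalAt {r : α → α → Prop} [Std.Refl r] [IsTrans α r]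
    {out : ℕ → (Fin n → Word s) → α} (h : IsMono r out) {ws : ℕ → Fin n → Word s}
    {p : Fin n → Seq s} (hws : ∀ j, ConvergesTo (fun m => ws m j) (p j)) (k : ℕ) :
    ∀ᶠ m in atTop, r (out k (preTuple p k)) (evalAt out m (ws m)) := by
  filter_upwards [eventually_ge_atTop k, eventually_all.2 fun j => hws j k] with m hm hk
  rw [← evalAt_preTuple out k p]
  exact h.rel_evalAt hm hk

theorem ComputesSeq.convergesTo_evalAt {out : ℕ → (Fin n → Word s) → Word s}
    {F : (Fin n → Seq s) →. Seq s} (h : ComputesSeq out F) {ws : ℕ → Fin n → Word s}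
    {p : Fin n → Seq s} (hws : ∀ j, ConvergesTo (fun m => ws m j) (p j)) {q : Seq s}
    (hq : q ∈ F p) : ConvergesTo (fun m => evalAt out m (ws m)) q := fun k => by
  obtain ⟨m, hm⟩ := h.exists_pre_prefix hq k
  exact (h.1.eventually_rel_evalAt hws m).mono fun _ => hm.trans

theorem ComputesValue.eventually_evalAt_eq {out : ℕ → (Fin n → Word s) → Option α}
    {F : (Fin n → Seq s) →. α} (h : ComputesValue out F) {ws : ℕ → Fin n → Word s}
    {p : Fin n → Seq s} (hws : ∀ j, ConvergesTo (fun m => ws m j) (p j)) {a : α}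
    (ha : a ∈ F p) : ∀ᶠ m in atTop, evalAt out m (ws m) = some a := by
  obtain ⟨k, hk⟩ := h.2 p a ha
  exact (h.1.eventually_rel_evalAt hws k).mono fun _ hm => hm a hk

end Level


/-! ### Oracle machines on words -/

section Tapes

/-- The content of the tapes of a machine on words: the positions of the heads and the written
cells, last written first; later entries for the same cell are overwritten by earlier ones. -/
abbrev Tapes (s L : ℕ) (Γ : Type) :=
  (Fin (L + 1) → ℤ) × List ((Fin (L + 1) × ℤ) × (Word s ⊕ Γ))

variable {s L : ℕ} {Γ : Type}

/-- The word in a cell; a cell containing a symbol of the work alphabet counts as empty. -/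
def cellWord : Word s ⊕ Γ → Word s := Sum.elim id fun _ => []

/-- The order on contents of cells: a word may be extended, a symbol remains the same. -/
abbrev CellLe : Word s ⊕ Γ → Word s ⊕ Γ → Prop := Sum.LiftRel (· <+: ·) (· = ·)

theorem CellLe.cellWord_prefix {x x' : Word s ⊕ Γ} (h : CellLe x x') :
    cellWord x <+: cellWord x' := by
  cases h with
  | inl h => exact h
  | inr _ => exact List.prefix_rfl

theorem CellLe.eq_inr_iff {x x' : Word s ⊕ Γ} (h : CellLe x x') (a : Γ) :
    x = .inr a ↔ x' = .inr a := by
  cases h with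
  | inl _ => simp
  | inr h => rw [h]

namespace Tapes

variable (b : Γ)

/-- The content of cell `z` of tape `i`, where `b` is the blank. -/
def lookup (T : Tapes s L Γ) (i : Fin (L + 1)) (z : ℤ) : Word s ⊕ Γ :=
  T.2.foldr (fun e x => if e.1 = (i, z) then e.2 else x) (.inr b)

/-- The content of the cell scanned on tape `i`, where `b` is the blank. -/
def scan (T : Tapes s L Γ) (i : Fin (L + 1)) : Word s ⊕ Γ := T.lookup b i (T.1 i)

/-- The word scanned on tape `i`. -/
def word (T : Tapes s L Γ) (i : Fin (L + 1)) : Word s := cellWord (T.scan b i)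

/-- Move the head of tape `i` by `d` cells. -/
def move (T : Tapes s L Γ) (i : Fin (L + 1)) (d : ℤ) : Tapes s L Γ :=
  (Function.update T.1 i (T.1 i + d), T.2)

/-- Write `x` on the cell scanned on tape `i`. -/
def put (T : Tapes s L Γ) (i : Fin (L + 1)) (x : Word s ⊕ Γ) : Tapes s L Γ :=
  (T.1, ((i, T.1 i), x) :: T.2)

theorem lookup_put (T : Tapes s L Γ) (i : Fin (L + 1)) (x : Word s ⊕ Γ) (j : Fin (L + 1))
    (z : ℤ) : (T.put i x).lookup b j z = if (i, T.1 i) = (j, z) then x else T.lookup b j z :=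
  rfl

/-- `T'` is obtained from `T` by extending the words in the cells. -/
def Le (T T' : Tapes s L Γ) : Prop :=
  T.1 = T'.1 ∧ ∀ i z, CellLe (T.lookup b i z) (T'.lookup b i z)

variable {b} {T T' : Tapes s L Γ}

theorem Le.refl (T : Tapes s L Γ) : T.Le b T := ⟨rfl, fun _ _ => Sum.LiftRel.refl _ _ _⟩

theorem Le.scan (h : T.Le b T') (i : Fin (L + 1)) : CellLe (T.scan b i) (T'.scan b i) := by
  unfold Tapes.scan
  rw [← h.1]
  exact h.2 i (T.1 i)

theorem Le.word (h : T.Le b T') (i : Fin (L + 1)) : T.word b i <+: T'.word b i :=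
  (h.scan i).cellWord_prefix

theorem Le.move (h : T.Le b T') (i : Fin (L + 1)) (d : ℤ) : (T.move i d).Le b (T'.move i d) :=
  ⟨by simp only [Tapes.move, h.1], h.2⟩

theorem Le.put (h : T.Le b T') (i : Fin (L + 1)) {x x' : Word s ⊕ Γ} (hx : CellLe x x') :
    (T.put i x).Le b (T'.put i x') := by
  refine ⟨h.1, fun j z => ?_⟩
  rw [lookup_put, lookup_put, h.1]
  split
  · exact hx
  · exact h.2 j z

end Tapes

end Tapes

section OracleMachine

/-- The instructions of a machine on words, where `Γ` is the work alphabet and `Λ` is the set of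
labels.  Assignments and tests are given by monotone procedures on prefixes, and there are oracle
calls. -/
inductive Instr (s L : ℕ) (Γ Λ : Type) : Type
  | right (i : Fin (L + 1)) (l : Λ)
  | left (i : Fin (L + 1)) (l : Λ)
  | write (i : Fin (L + 1)) (a : Γ) (l : Λ)
  | ifSymbol (i : Fin (L + 1)) (a : Γ) (l l' : Λ)
  | assign (i : Fin (L + 1)) {n : ℕ} (src : Fin n → Fin (L + 1))
      (out : ℕ → (Fin n → Word s) → Word s) (hout : IsMono (· <+: ·) out) (l : Λ)
  | test {n : ℕ} (src : Fin n → Fin (L + 1))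
      (out : ℕ → (Fin n → Word s) → Option (Word s)) (hout : IsMono OptLe out) (l l' : Λ)
  /-- Ask the oracle about the word scanned on tape `i₁`, and write the answer on tape `i`. -/
  | call (i₁ i : Fin (L + 1)) (l : Λ)
  | halt

variable {s L : ℕ} {Γ Λ : Type}

/-- A configuration of a machine on words: a label and the tapes. -/
abbrev WordConfig (s L : ℕ) (Γ Λ : Type) := Λ × Tapes s L Γ

/-- `D` is obtained from `C` by extending the words in the cells; `b` is the blank. -/
def WordConfig.Le (b : Γ) (C D : WordConfig s L Γ Λ) : Prop := C.1 = D.1 ∧ C.2.Le b D.2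

open Classical in
/-- Execute an instruction in stage `m`, when `ρ` is the known part of the answer of the oracle.
The machine waits at an oracle call if there is no oracle (`ρ = none`), and it also waits after
halting.  The result is `none` if the result of a test is not known in stage `m`. -/
noncomputable def Instr.exec (b : Γ) (m : ℕ) (ρ : Option (Word s)) (C : WordConfig s L Γ Λ) :
    Instr s L Γ Λ → Option (WordConfig s L Γ Λ)
  | .right i l => some (l, C.2.move i 1)
  | .left i l => some (l, C.2.move i (-1))
  | .write i a l => some (l, C.2.put i (.inr a))
  | .ifSymbol i a l l' => some (if C.2.scan b i = .inr a then l else l', C.2)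
  | .assign i src out _ l =>
      some (l, C.2.put i (.inl (evalAt out m fun j => C.2.word b (src j))))
  | .test src out _ l l' =>
      (evalAt out m fun j => C.2.word b (src j)).map fun w => (if w = [0] then l else l', C.2)
  | .call _ i l => some (ρ.elim C fun r => (l, C.2.put i (.inl r)))
  | .halt => some C

/-- The machine waits at this instruction, when `ρ` is the known part of the answer of the
oracle. -/
def Instr.Waits (ρ : Option (Word s)) : Instr s L Γ Λ → Prop
  | .call _ _ _ => ρ = none
  | .halt => True
  | _ => False

theorem Instr.Waits.exec_eq {ρ : Option (Word s)} {I : Instr s L Γ Λ} (h : I.Waits ρ) (b : Γ)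
    (m : ℕ) (C : WordConfig s L Γ Λ) : I.exec b m ρ C = some C := by
  cases I with
  | call _ _ _ => obtain rfl : ρ = none := h; rfl
  | halt => rfl
  | _ => exact h.elim

theorem Instr.exec_mono {b : Γ} {m m' : ℕ} (hm : m ≤ m') {ρ ρ' : Option (Word s)}
    (hρ : Option.Rel (· <+: ·) ρ ρ') {C C' D : WordConfig s L Γ Λ} (hC : C.Le b C')
    {I : Instr s L Γ Λ} (hD : I.exec b m ρ C = some D) :
    ∃ D', I.exec b m' ρ' C' = some D' ∧ D.Le b D' := by
  obtain ⟨hl, hT⟩ := hC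
  cases I
  case test n src out hout l l' =>
    obtain ⟨w, hw, rfl⟩ := Option.map_eq_some_iff.1 hD
    have hw' := hout.rel_evalAt hm (fun j => hT.word (src j)) w hw
    exact ⟨(_, C'.2), Option.map_eq_some_iff.2 ⟨w, hw', rfl⟩, rfl, hT⟩
  all_goals
    obtain rfl := Option.some.inj hD
    refine ⟨_, rfl, ?_⟩
  case right i l => exact ⟨rfl, hT.move i _⟩
  case left i l => exact ⟨rfl, hT.move i _⟩
  case write i a l => exact ⟨rfl, hT.put i (.inr rfl)⟩
  case ifSymbol i a l l' => classical exact ⟨if_congr ((hT.scan i).eq_inr_iff a) rfl rfl, hT⟩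
  case assign i n src out hout l =>
    exact ⟨rfl, hT.put i (.inl (hout.rel_evalAt hm fun j => hT.word (src j)))⟩
  case call i₁ i l =>
    cases hρ with
    | none => exact ⟨hl, hT⟩
    | some h => exact ⟨rfl, hT.put i (.inl h)⟩
  case halt => exact ⟨hl, hT⟩

/-- A machine on words with tapes `0, …, L`, of which tape `0` is the output tape. -/
structure OracleMachine (s L : ℕ) (Γ Λ : Type) where
  blank : Γ
  start : Λ
  /-- The input tape. -/
  input : Fin (L + 1)
  prog : Λ → Instr s L Γ Λ

namespace OracleMachine

variable (M : OracleMachine s L Γ Λ)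

/-- One step of the machine in stage `m`, when `ρ` is the known part of the answer of the
oracle. -/
noncomputable def step (m : ℕ) (ρ : Option (Word s)) (C : WordConfig s L Γ Λ) :
    Option (WordConfig s L Γ Λ) :=
  (M.prog C.1).exec M.blank m ρ C

/-- The result of `n` steps of the machine in stage `m`, when `ρ` is the known part of the answer
of the oracle. -/
noncomputable def run (m : ℕ) (ρ : Option (Word s)) (n : ℕ) (C : WordConfig s L Γ Λ) :
    Option (WordConfig s L Γ Λ) :=
  n.rec (some C) fun _ D => D.bind (M.step m ρ)

variable {M}

theorem run_succ (m : ℕ) (ρ : Option (Word s)) (n : ℕ) (C : WordConfig s L Γ Λ) :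
    M.run m ρ (n + 1) C = (M.run m ρ n C).bind (M.step m ρ) :=
  rfl

theorem run_add (m : ℕ) (ρ : Option (Word s)) (n k : ℕ) (C : WordConfig s L Γ Λ) :
    M.run m ρ (n + k) C = (M.run m ρ n C).bind (M.run m ρ k) := by
  induction k with
  | zero => exact (Option.bind_fun_some _).symm
  | succ k ih => rw [← Nat.add_assoc, run_succ, ih, Option.bind_assoc]; rfl

theorem run_mono {m m' : ℕ} (hm : m ≤ m') {ρ ρ' : Option (Word s)}
    (hρ : Option.Rel (· <+: ·) ρ ρ') (n : ℕ) {C C' D : WordConfig s L Γ Λ}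
    (hC : C.Le M.blank C') (hD : M.run m ρ n C = some D) :
    ∃ D', M.run m' ρ' n C' = some D' ∧ D.Le M.blank D' := by
  induction n generalizing D with
  | zero =>
    obtain rfl := Option.some.inj hD
    exact ⟨C', rfl, hC⟩
  | succ n ih =>
    obtain ⟨E, hE, hD⟩ := Option.bind_eq_some_iff.1 hD
    obtain ⟨E', hE', hle⟩ := ih hE
    obtain ⟨D', hD', hDD'⟩ := Instr.exec_mono hm hρ hle hD
    refine ⟨D', ?_, hDD'⟩
    rw [run_succ, hE', Option.bind_some, step, ← hle.1, hD']

theorem run_eq_of_waits {m n n' : ℕ} (hn : n ≤ n') {ρ : Option (Word s)}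
    {C D : WordConfig s L Γ Λ} (hD : M.run m ρ n C = some D) (h : (M.prog D.1).Waits ρ) :
    M.run m ρ n' C = some D := by
  induction n', hn using Nat.le_induction with
  | base => exact hD
  | succ n' _ ih => rw [run_succ, ih, Option.bind_some, step, h.exec_eq]

/-- For some `n`, the machine eventually reaches `D m` from `C m` in `n` steps of stage `m`, when
`ρ m` is the known part of the answer of the oracle. -/
def Leads (M : OracleMachine s L Γ Λ) (ρ : ℕ → Option (Word s))
    (C D : ℕ → WordConfig s L Γ Λ) : Prop :=
  ∃ n, ∀ᶠ m in atTop, M.run m (ρ m) n (C m) = some (D m)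

variable {ρ : ℕ → Option (Word s)} {C D E : ℕ → WordConfig s L Γ Λ}

theorem Leads.refl (ρ : ℕ → Option (Word s)) (C : ℕ → WordConfig s L Γ Λ) : M.Leads ρ C C :=
  ⟨0, .of_forall fun _ => rfl⟩

theorem Leads.of_step (h : ∀ᶠ m in atTop, M.step m (ρ m) (C m) = some (D m)) :
    M.Leads ρ C D :=
  ⟨1, h⟩

theorem Leads.trans (h : M.Leads ρ C D) (h' : M.Leads ρ D E) : M.Leads ρ C E := by
  obtain ⟨n, hn⟩ := h
  obtain ⟨k, hk⟩ := h'
  refine ⟨n + k, ?_⟩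
  filter_upwards [hn, hk] with m hn hk
  rw [run_add, hn, Option.bind_some, hk]

theorem Leads.eventually_run_eq (h : M.Leads ρ C D) (hw : ∀ m, (M.prog (D m).1).Waits (ρ m)) :
    ∀ᶠ m in atTop, M.run m (ρ m) m (C m) = some (D m) := by
  obtain ⟨n, hn⟩ := h
  filter_upwards [hn, eventually_ge_atTop n] with m hm hnm
  exact run_eq_of_waits hnm hm (hw m)

/-! ### The question and the result -/

variable (M)

/-- The initial configuration with `w` on the input tape. -/
def init (w : Word s) : WordConfig s L Γ Λ :=
  (M.start, fun _ => 0, [((M.input, 0), .inl w)])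

/-- The word `o C` read off in the configuration `C` that is reached from the input `w` after
`m` steps of stage `m`, when `ρ` is the known part of the answer of the oracle. -/
noncomputable def readOut (o : WordConfig s L Γ Λ → Word s) (m : ℕ) (ρ : Option (Word s))
    (w : Word s) : Word s :=
  (M.run m ρ m (M.init w)).elim [] o

/-- The word in cell `0` of the output tape, after halting. -/
def result (C : WordConfig s L Γ Λ) : Word s :=
  match M.prog C.1 with
  | .halt => cellWord (C.2.lookup M.blank 0 0)
  | _ => []

/-- The word about which the oracle is asked; after halting, this is `d`. -/
def question (d : Word s) (C : WordConfig s L Γ Λ) : Word s :=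
  match M.prog C.1 with
  | .halt => d
  | .call i₁ _ _ => C.2.word M.blank i₁
  | _ => []

/-- The procedure computing the result from the input and the answer of the oracle. -/
noncomputable def resultProc (m : ℕ) (u : Fin 2 → Word s) : Word s :=
  M.readOut M.result m (some (u 1)) (u 0)

/-- The procedure computing the question to the oracle from the input; the default question is
`p₀`. -/
noncomputable def questionProc (p₀ : Seq s) (m : ℕ) (u : Fin 1 → Word s) : Word s :=
  M.readOut (M.question (p₀.pre m)) m none (u 0)

variable {M}

theorem init_le {w w' : Word s} (h : w <+: w') : (M.init w).Le M.blank (M.init w') :=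
  ⟨rfl, (Tapes.Le.refl (fun _ => 0, [])).put M.input (.inl h)⟩

theorem result_mono {C C' : WordConfig s L Γ Λ} (h : C.Le M.blank C') :
    M.result C <+: M.result C' := by
  unfold result
  rw [h.1]
  split
  · exact (h.2.2 0 0).cellWord_prefix
  · exact List.prefix_rfl

theorem question_mono {d d' : Word s} (hd : d <+: d') {C C' : WordConfig s L Γ Λ}
    (h : C.Le M.blank C') : M.question d C <+: M.question d' C' := by
  unfold question
  rw [h.1]
  split
  · exact hd
  · exact h.2.word _
  · exact List.prefix_rfl

theorem waits_of_result_ne_nil {C : WordConfig s L Γ Λ} (h : M.result C ≠ [])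
    (ρ : Option (Word s)) : (M.prog C.1).Waits ρ := by
  unfold result at h
  split at h
  · next hhalt => rw [hhalt]; trivial
  · exact absurd rfl h

theorem waits_of_question_ne_nil {d : Word s} {C : WordConfig s L Γ Λ}
    (h : M.question d C ≠ []) : (M.prog C.1).Waits none := by
  unfold question at h
  split at h
  · next hhalt => rw [hhalt]; trivial
  · next hcall => rw [hcall]; rfl
  · exact absurd rfl h

theorem readOut_prefix_readOut {m m' : ℕ} (hm : m ≤ m') {ρ ρ' : Option (Word s)}
    (hρ : Option.Rel (· <+: ·) ρ ρ') {w w' : Word s} (hw : w <+: w')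
    {o o' : WordConfig s L Γ Λ → Word s} (ho : ∀ D D', D.Le M.blank D' → o D <+: o' D')
    (hwaits : ∀ D, o D ≠ [] → (M.prog D.1).Waits ρ') :
    M.readOut o m ρ w <+: M.readOut o' m' ρ' w' := by
  unfold readOut
  cases hD : M.run m ρ m (M.init w) with
  | none => exact List.nil_prefix
  | some D =>
    by_cases hne : o D = []
    · simp only [Option.elim_some, hne, List.nil_prefix]
    · obtain ⟨D', hD', hle⟩ := run_mono hm hρ m (init_le hw) hD
      rw [run_eq_of_waits hm hD' (hle.1 ▸ hwaits D hne)]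
      exact ho D D' hle

theorem isMono_resultProc (M : OracleMachine s L Γ Λ) : IsMono (· <+: ·) M.resultProc :=
  fun p m => readOut_prefix_readOut m.le_succ (.some ((p 1).pre_prefix_pre m.le_succ))
    ((p 0).pre_prefix_pre m.le_succ) (fun _ _ => result_mono)
    fun _ h => waits_of_result_ne_nil h _

theorem isMono_questionProc (M : OracleMachine s L Γ Λ) (p₀ : Seq s) :
    IsMono (· <+: ·) (M.questionProc p₀) :=
  fun p m => readOut_prefix_readOut m.le_succ .none ((p 0).pre_prefix_pre m.le_succ)
    (fun _ _ => question_mono (p₀.pre_prefix_pre m.le_succ)) fun _ => waits_of_question_ne_nil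

variable (M)

/-- The result as a partial function of the input and the answer of the oracle. -/
noncomputable def resultFun : (Fin 2 → Seq s) →. Seq s := limFun M.resultProc

/-- The question to the oracle as a partial function of the input; the default question is
`p₀`. -/
noncomputable def questionFun (p₀ : Seq s) : (Fin 1 → Seq s) →. Seq s :=
  limFun (M.questionProc p₀)

variable {M} {p : Seq s} {l : Λ} {T : ℕ → Tapes s L Γ}

theorem Leads.eventually_readOut_eq
    (h : M.Leads ρ (fun m => M.init (p.pre m)) fun m => (l, T m))
    (hw : ∀ m, (M.prog l).Waits (ρ m)) (o : ℕ → WordConfig s L Γ Λ → Word s) :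
    ∀ᶠ m in atTop, M.readOut (o m) m (ρ m) (p.pre m) = o m (l, T m) := by
  filter_upwards [h.eventually_run_eq hw] with m hm
  rw [readOut, hm, Option.elim_some]

theorem Leads.mem_resultFun {q r : Seq s}
    (h : M.Leads (fun m => some (r.pre m)) (fun m => M.init (p.pre m)) fun m => (l, T m))
    (hl : M.prog l = .halt)
    (hq : ConvergesTo (fun m => cellWord ((T m).lookup M.blank 0 0)) q) :
    q ∈ M.resultFun ![p, r] := by
  refine mem_limFun.2 (hq.congr ?_)
  filter_upwards [h.eventually_readOut_eq (fun _ => by rw [hl]; trivial) fun _ => M.result]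
    with m hm
  exact (hm.trans (by simp only [result, hl])).symm

theorem Leads.mem_questionFun_of_call {p₀ q : Seq s} {i₁ i : Fin (L + 1)} {l' : Λ}
    (h : M.Leads (fun _ => none) (fun m => M.init (p.pre m)) fun m => (l, T m))
    (hl : M.prog l = .call i₁ i l') (hq : ConvergesTo (fun m => (T m).word M.blank i₁) q) :
    q ∈ M.questionFun p₀ ![p] := by
  refine mem_limFun.2 (hq.congr ?_)
  filter_upwards [h.eventually_readOut_eq (fun _ => by rw [hl]; rfl)
    fun m => M.question (p₀.pre m)] with m hm
  exact (hm.trans (by simp only [question, hl])).symm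

theorem Leads.mem_questionFun_of_halt {p₀ : Seq s}
    (h : M.Leads (fun _ => none) (fun m => M.init (p.pre m)) fun m => (l, T m))
    (hl : M.prog l = .halt) : p₀ ∈ M.questionFun p₀ ![p] := by
  refine mem_limFun.2 ((convergesTo_pre p₀).congr ?_)
  filter_upwards [h.eventually_readOut_eq (fun _ => by rw [hl]; trivial)
    fun m => M.question (p₀.pre m)] with m hm
  exact (hm.trans (by simp only [question, hl])).symm

end OracleMachine

end OracleMachine

/-! ### Computability of the procedures -/

section Computability

theorem computable₂_of_finite {α β σ : Type*} [Primcodable α] [Primcodable β] [Primcodable σ]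
    [Finite α] {f : α → β → σ} (h : ∀ a, Computable (f a)) : Computable₂ f := by
  obtain ⟨n, ⟨e⟩⟩ := Finite.exists_equiv_fin α
  refine (Computable.vector_get.comp
    (Computable.vector_ofFn fun i => (h (e.symm i)).comp Computable.snd)
    ((Primrec.dom_finite e).to_comp.comp Computable.fst)).of_eq fun x => ?_
  simp only [List.Vector.get_ofFn, Equiv.symm_apply_apply]

theorem primrec_int_add_one : Primrec fun z : ℤ => z + 1 := by
  have hodd : PrimrecPred fun z : ℤ => Encodable.encode z % 2 = 1 :=
    Primrec.eq.comp (Primrec.nat_mod.comp Primrec.encode (Primrec.const 2)) (Primrec.const 1)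
  refine Primrec.encode_iff.1 ((Primrec.ite hodd
    (Primrec.nat_sub.comp Primrec.encode (Primrec.const 2))
    (Primrec.nat_add.comp Primrec.encode (Primrec.const 2))).of_eq ?_)
  rintro (n | _ | n)
  · have : Encodable.encode (Int.ofNat n) = 2 * n := rfl
    have : Encodable.encode (Int.ofNat n + 1) = 2 * (n + 1) := rfl
    split_ifs <;> omega
  · rfl
  · have : Encodable.encode (Int.negSucc (n + 1)) = 2 * (n + 1) + 1 := rfl
    have : Encodable.encode (Int.negSucc (n + 1) + 1) = 2 * n + 1 := rfl
    split_ifs <;> omega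

theorem primrec_int_neg : Primrec fun z : ℤ => -z := by
  have hodd : PrimrecPred fun z : ℤ => Encodable.encode z % 2 = 1 :=
    Primrec.eq.comp (Primrec.nat_mod.comp Primrec.encode (Primrec.const 2)) (Primrec.const 1)
  refine Primrec.encode_iff.1 ((Primrec.ite hodd (Primrec.succ.comp Primrec.encode)
    (Primrec.nat_sub.comp Primrec.encode (Primrec.const 1))).of_eq ?_)
  rintro ((_ | n) | n)
  · rfl
  · have : Encodable.encode (Int.ofNat (n + 1)) = 2 * (n + 1) := rfl
    have : Encodable.encode (-Int.ofNat (n + 1)) = 2 * n + 1 := rfl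
    split_ifs <;> omega
  · have : Encodable.encode (Int.negSucc n) = 2 * n + 1 := rfl
    have : Encodable.encode (-Int.negSucc n) = 2 * (n + 1) := rfl
    split_ifs <;> omega

theorem primrec_int_add (d : ℤ) : Primrec fun z : ℤ => z + d := by
  induction d with
  | zero => exact Primrec.id.of_eq fun z => (add_zero z).symm
  | succ n ih => exact (primrec_int_add_one.comp ih).of_eq fun z => add_assoc z n 1
  | pred n ih =>
    refine (primrec_int_neg.comp (primrec_int_add_one.comp (primrec_int_neg.comp ih))).of_eq ?_
    intro z
    ring

variable {s L n : ℕ}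

section Stage

variable {α σ : Type*} [Primcodable α] [Primcodable σ]

theorem primrec_level {m : α → ℕ} {ws : α → Fin n → Word s} (hm : Primrec m)
    (hws : ∀ j, Primrec fun a => ws a j) : Primrec fun a => level (m a) (ws a) :=
  Primrec.list_foldr (Primrec.list_ofFn hws) hm
    (Primrec.nat_min.comp (Primrec.list_length.comp (Primrec.fst.comp Primrec.snd))
      (Primrec.snd.comp Primrec.snd)).to₂

theorem computable_evalAt {out : ℕ → (Fin n → Word s) → σ} (hout : Computable₂ out)
    {m : α → ℕ} {ws : α → Fin n → Word s} (hm : Primrec m)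
    (hws : ∀ j, Primrec fun a => ws a j) : Computable fun a => evalAt out (m a) (ws a) := by
  have hl := primrec_level hm hws
  refine hout.comp hl.to_comp (Primrec.to_comp ?_)
  exact Primrec.fin_curry.2
    (Primrec.fin_curry₁.2 fun j => Primrec.list_take.comp hl (hws j)).swap

end Stage

variable {Γ Λ : Type} [Primcodable Γ] [Primcodable Λ] {α : Type*} [Primcodable α]

theorem primrec_cellWord : Primrec (cellWord : Word s ⊕ Γ → Word s) :=
  (Primrec.sumCasesOn Primrec.id (g := fun _ w => w) (h := fun _ _ => []) Primrec₂.right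
    (Primrec₂.const [])).of_eq fun x => by cases x <;> rfl

section Tapes

variable {T : α → Tapes s L Γ} (hT : Primrec T) (b : Γ) (i : Fin (L + 1))
include hT

theorem primrec_lookup {z : α → ℤ} (hz : Primrec z) :
    Primrec fun a => (T a).lookup b i (z a) := by
  have hentry : Primrec fun y : α × (((Fin (L + 1) × ℤ) × (Word s ⊕ Γ)) × (Word s ⊕ Γ)) => y.2.1 :=
    Primrec.fst.comp Primrec.snd
  exact Primrec.list_foldr (Primrec.snd.comp hT) (Primrec.const _) (Primrec.ite
    (Primrec.eq.comp (Primrec.fst.comp hentry)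
      (Primrec.pair (Primrec.const i) (hz.comp Primrec.fst)))
    (Primrec.snd.comp hentry) (Primrec.snd.comp Primrec.snd)).to₂

theorem primrec_head : Primrec fun a => (T a).1 i :=
  Primrec.fin_app.comp (Primrec.fst.comp hT) (Primrec.const i)

theorem primrec_scan : Primrec fun a => (T a).scan b i :=
  primrec_lookup hT b i (primrec_head hT i)

theorem primrec_word : Primrec fun a => (T a).word b i :=
  primrec_cellWord.comp (primrec_scan hT b i)

theorem primrec_move (d : ℤ) : Primrec fun a => (T a).move i d := by
  refine Primrec.pair (Primrec.fin_curry.2 ?_) (Primrec.snd.comp hT)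
  have hhead : Primrec fun x : α × Fin (L + 1) => (T x.1).1 x.2 :=
    Primrec.fin_app.comp (Primrec.fst.comp (hT.comp Primrec.fst)) Primrec.snd
  refine (Primrec.ite (Primrec.eq.comp Primrec.snd (Primrec.const i))
    ((primrec_int_add d).comp hhead) hhead).of_eq fun x => ?_
  simp only [Function.update_apply]
  split_ifs with h
  · rw [h]
  · rfl

theorem computable_put {x : α → Word s ⊕ Γ} (hx : Computable x) :
    Computable fun a => (T a).put i (x a) :=
  Computable.pair (Primrec.fst.comp hT).to_comp
    (Computable.list_cons.comp
      (Computable.pair ((Primrec.const i).pair (primrec_head hT i)).to_comp hx)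
      (Primrec.snd.comp hT).to_comp)

end Tapes

/-- The procedure of an assignment or a test has the property `P`. -/
def Instr.ProcSat {Γ Λ : Type}
    (P : ∀ {n : ℕ} {σ : Type} [Primcodable σ], (ℕ → (Fin n → Word s) → σ) → Prop) :
    Instr s L Γ Λ → Prop
  | .assign _ _ out _ _ => P out
  | .test _ out _ _ _ => P out
  | _ => True

/-- The procedure of an assignment or a test is computable. -/
abbrev Instr.IsComputable {Γ Λ : Type} (I : Instr s L Γ Λ) : Prop := I.ProcSat Computable₂

theorem Instr.IsComputable.exec (b : Γ) {I : Instr s L Γ Λ} (hI : I.IsComputable) :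
    Computable fun x : (ℕ × Option (Word s)) × WordConfig s L Γ Λ =>
      I.exec b x.1.1 x.1.2 x.2 := by
  classical
  have hm : Primrec fun x : (ℕ × Option (Word s)) × WordConfig s L Γ Λ => x.1.1 :=
    Primrec.fst.comp Primrec.fst
  have hρ : Primrec fun x : (ℕ × Option (Word s)) × WordConfig s L Γ Λ => x.1.2 :=
    Primrec.snd.comp Primrec.fst
  have hT : Primrec fun x : (ℕ × Option (Word s)) × WordConfig s L Γ Λ => x.2.2 :=
    Primrec.snd.comp Primrec.snd
  cases I with
  | right i l =>
    exact Computable.option_some.comp ((Computable.const l).pair (primrec_move hT i 1).to_comp)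
  | left i l =>
    exact Computable.option_some.comp ((Computable.const l).pair (primrec_move hT i (-1)).to_comp)
  | write i a l =>
    exact Computable.option_some.comp
      ((Computable.const l).pair (computable_put hT i (Computable.const _)))
  | ifSymbol i a l l' =>
    refine Computable.option_some.comp (Computable.pair (Primrec.to_comp ?_) hT.to_comp)
    exact Primrec.ite (Primrec.eq.comp (primrec_scan hT b i) (Primrec.const _))
      (Primrec.const l) (Primrec.const l')
  | assign i src out hout l =>
    exact Computable.option_some.comp ((Computable.const l).pair (computable_put hT i
      (Computable.sumInl.comp (computable_evalAt hI hm fun j => primrec_word hT b (src j)))))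
  | test src out hout l l' =>
    refine Computable.option_map
      (computable_evalAt hI hm fun j => primrec_word hT b (src j)) (Primrec.to_comp ?_)
    exact (Primrec.ite (Primrec.eq.comp Primrec.snd (Primrec.const _)) (Primrec.const l)
      (Primrec.const l')).pair (hT.comp Primrec.fst)
  | call i₁ i l =>
    refine Computable.option_some.comp ((Computable.option_casesOn hρ.to_comp Computable.snd
      (g := fun x r => (l, x.2.2.put i (.inl r))) ?_).of_eq fun x => ?_)
    · exact (Computable.const l).pair (computable_put (hT.comp Primrec.fst) i
        (Computable.sumInl.comp Computable.snd))
    · cases x.1.2 <;> rfl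
  | halt => exact Computable.option_some.comp Computable.snd

theorem Seq.computable_pre {p : Seq s} (hp : Computable p) : Computable p.pre := by
  refine (Computable.nat_rec (h := fun _ x => x.2 ++ [p x.1]) Computable.id
    (Computable.const []) ?_).of_eq fun m => ?_
  · exact Computable.list_append.comp (Computable.snd.comp Computable.snd)
      (Computable.list_cons.comp (hp.comp (Computable.fst.comp Computable.snd))
        (Computable.const []))
  · induction m with
    | zero => rfl
    | succ m ih =>
      rw [Seq.pre_succ, ← ih]
      rfl

namespace OracleMachine

variable {M : OracleMachine s L Γ Λ}

theorem computable_init (M : OracleMachine s L Γ Λ) : Computable M.init :=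
  (Computable.const _).pair ((Computable.const _).pair (Computable.list_cons.comp
    ((Computable.const _).pair Computable.sumInl) (Computable.const [])))

variable [Finite Λ]

theorem computable_result (M : OracleMachine s L Γ Λ) : Computable M.result := by
  have : Computable₂ fun (l : Λ) (T : Tapes s L Γ) => M.result (l, T) := by
    refine computable₂_of_finite fun l => ?_
    cases h : M.prog l
    case halt =>
      simp only [result, h]
      exact (primrec_cellWord.comp (primrec_lookup Primrec.id _ 0 (Primrec.const 0))).to_comp
    all_goals
      simp only [result, h]
      exact Computable.const _
  exact this

theorem computable_question (M : OracleMachine s L Γ Λ) : Computable₂ M.question := by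
  have : Computable₂ fun (l : Λ) (x : Word s × Tapes s L Γ) => M.question x.1 (l, x.2) := by
    refine computable₂_of_finite fun l => ?_
    cases h : M.prog l
    case halt =>
      simp only [question, h]
      exact Computable.fst
    case call i₁ i l' =>
      simp only [question, h]
      exact (primrec_word Primrec.snd _ i₁).to_comp
    all_goals
      simp only [question, h]
      exact Computable.const _
  exact this.comp (Computable.fst.comp Computable.snd)
    (Computable.fst.pair (Computable.snd.comp Computable.snd))

variable (hM : ∀ l, (M.prog l).IsComputable)
include hM

theorem computable_step :
    Computable₂ fun (x : ℕ × Option (Word s)) (C : WordConfig s L Γ Λ) => M.step x.1 x.2 C :=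
  (computable₂_of_finite fun l => (hM l).exec M.blank).comp (Computable.fst.comp Computable.snd)
    Computable.id

theorem computable_run {m n : α → ℕ} {ρ : α → Option (Word s)} {C : α → WordConfig s L Γ Λ}
    (hm : Computable m) (hn : Computable n) (hρ : Computable ρ) (hC : Computable C) :
    Computable fun a => M.run (m a) (ρ a) (n a) (C a) := by
  have hstep : Computable₂ fun (a : α) (y : ℕ × Option (WordConfig s L Γ Λ)) =>
      y.2.bind (M.step (m a) (ρ a)) :=
    Computable.option_bind (Computable.snd.comp Computable.snd) ((computable_step hM).comp
      ((hm.pair hρ).comp (Computable.fst.comp Computable.fst)) Computable.snd)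
  exact Computable.nat_rec hn (Computable.option_some.comp hC) hstep

theorem computable_readOut {o : α → WordConfig s L Γ Λ → Word s} {m : α → ℕ}
    {ρ : α → Option (Word s)} {w : α → Word s} (ho : Computable₂ o) (hm : Computable m)
    (hρ : Computable ρ) (hw : Computable w) :
    Computable fun a => M.readOut (o a) (m a) (ρ a) (w a) :=
  (Computable.option_casesOn (computable_run hM hm hm hρ (M.computable_init.comp hw))
    (Computable.const []) ho).of_eq fun a => by
      unfold readOut
      cases M.run (m a) (ρ a) (m a) (M.init (w a)) <;> rfl

end OracleMachine

end Computability

section FiniteAlphabet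

variable {s L : ℕ} {Γ Λ : Type} [Finite Γ] [Finite Λ] {M : OracleMachine s L Γ Λ}

namespace OracleMachine

theorem computable_resultProc (hM : ∀ l, (M.prog l).IsComputable) :
    Computable₂ M.resultProc := by
  let _ : Primcodable Γ := Primcodable.ofEquiv _ (Finite.equivFin Γ)
  let _ : Primcodable Λ := Primcodable.ofEquiv _ (Finite.equivFin Λ)
  have harg (i : Fin 2) : Computable fun x : ℕ × (Fin 2 → Word s) => x.2 i :=
    Computable.fin_app.comp Computable.snd (Computable.const i)
  exact computable_readOut hM (M.computable_result.comp Computable.snd) Computable.fst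
    (Computable.option_some.comp (harg 1)) (harg 0)

theorem computable_questionProc (hM : ∀ l, (M.prog l).IsComputable) {p₀ : Seq s}
    (hp₀ : Computable p₀) : Computable₂ (M.questionProc p₀) := by
  let _ : Primcodable Γ := Primcodable.ofEquiv _ (Finite.equivFin Γ)
  let _ : Primcodable Λ := Primcodable.ofEquiv _ (Finite.equivFin Λ)
  exact computable_readOut hM
    (M.computable_question.comp
      ((Seq.computable_pre hp₀).comp (Computable.fst.comp Computable.fst)) Computable.snd)
    Computable.fst (Computable.const none)
    (Computable.fin_app.comp Computable.snd (Computable.const 0))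

end OracleMachine

end FiniteAlphabet

/-! ### Computations of generalized Turing machines -/

section Chains

variable {α : Type*} {r : α → α → Prop} {a b : α} {c : ℕ → α} {n : ℕ}

theorem chain_update (hc : ∀ i < n, r (c i) (c (i + 1))) (hb : r (c n) b) :
    ∀ i < n + 1, r (Function.update c (n + 1) b i) (Function.update c (n + 1) b (i + 1)) := by
  intro i hi
  rw [Function.update_of_ne hi.ne]
  rcases Nat.lt_succ_iff_lt_or_eq.1 hi with hlt | rfl
  · rw [Function.update_of_ne (by omega)]
    exact hc i hlt
  · rwa [Function.update_self]

theorem exists_chain_extending (hc : ∀ i < n, r (c i) (c (i + 1)))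
    (h : Relation.TransGen r (c n) b) :
    ∃ (c' : ℕ → α) (n' : ℕ), n < n' ∧ (∀ i ≤ n, c' i = c i) ∧ c' n' = b ∧
      ∀ i < n', r (c' i) (c' (i + 1)) := by
  induction h with
  | single hb =>
    exact ⟨_, n + 1, n.lt_succ_self, fun i hi => Function.update_of_ne (by omega) _ _,
      Function.update_self .., chain_update hc hb⟩
  | tail _ hb ih =>
    obtain ⟨c', n', hn, heq, rfl, hc'⟩ := ih
    exact ⟨_, n' + 1, by omega, fun i hi =>
      (Function.update_of_ne (by omega) _ _).trans (heq i hi),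
      Function.update_self .., chain_update hc' hb⟩

theorem exists_chain (h : Relation.ReflTransGen r a b) :
    ∃ (c : ℕ → α) (n : ℕ), c 0 = a ∧ c n = b ∧ ∀ i < n, r (c i) (c (i + 1)) := by
  rcases Relation.reflTransGen_iff_eq_or_transGen.1 h with rfl | h
  · exact ⟨fun _ => b, 0, rfl, rfl, fun i hi => absurd hi i.not_lt_zero⟩
  · obtain ⟨c, n, -, hc0, hcn, hc⟩ := exists_chain_extending (c := fun _ => a) (n := 0)
      (fun i hi => absurd hi i.not_lt_zero) h
    exact ⟨c, n, hc0 0 le_rfl, hcn, hc⟩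

end Chains

namespace GTM

section Terminates

variable {s L : ℕ} {X : Fin (L + 1) → Type u} {N : GTM s X} {κ κ' : N.Config}

theorem Step.edge (h : Step κ κ') : N.Edge κ.label κ'.label := by
  obtain ⟨h0, h⟩ := h
  refine ⟨h0, ?_⟩
  revert h
  cases N.stm κ.label h0 with
  | ifSymbol i a l l' =>
    rintro (⟨-, rfl⟩ | ⟨-, rfl⟩)
    · exact .inl rfl
    · exact .inr rfl
  | assign i src c l => rintro ⟨v, -, x, -, rfl⟩; rfl
  | test src t h l l' =>
    rintro ⟨v, -, ⟨-, rfl⟩ | ⟨-, rfl⟩⟩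
    · exact .inl rfl
    · exact .inr rfl
  | _ => rintro rfl; rfl

/-- Every maximal computation with first configuration `κ` is finite and ends with the final
label. -/
inductive Terminates : N.Config → Prop
  | intro (κ : N.Config) (exists_step : κ.label ≠ N.final → ∃ κ', Step κ κ')
      (next : ∀ κ', Step κ κ' → Terminates κ') : Terminates κ

theorem Terminates.exists_step (h : Terminates κ) (hκ : κ.label ≠ N.final) :
    ∃ κ', Step κ κ' := by
  cases h with
  | intro _ hstep _ => exact hstep hκ

theorem Terminates.next (h : Terminates κ) (hs : Step κ κ') : Terminates κ' := by
  cases h with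
  | intro _ _ hnext => exact hnext κ' hs

theorem Terminates.of_reflTransGen (h : Terminates κ) (hs : Relation.ReflTransGen Step κ κ') :
    Terminates κ' := by
  induction hs with
  | refl => exact h
  | tail _ hs ih => exact ih.next hs

variable {x : ∀ j, X (N.inputTape j)}

theorem terminates_of_mem_dom (hx : x ∈ N.compute.dom) : Terminates (N.init x) := by
  obtain ⟨x₀, ⟨hinf, hmax⟩, -⟩ := hx
  have hacc : Acc (fun κ' κ : N.Config => Step κ κ') (N.init x) := by
    by_contra hacc
    exact hinf (not_acc_iff_exists_descending_chain.1 hacc)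
  suffices ∀ κ, Acc (fun κ' κ : N.Config => Step κ κ') κ →
      Relation.ReflTransGen Step (N.init x) κ → Terminates κ from this _ hacc .refl
  intro κ hκ
  induction hκ with
  | intro κ _ ih =>
    refine fun h => .intro κ (fun hlabel => ?_) fun κ' hs => ih κ' hs (h.tail hs)
    by_contra! hstuck
    obtain ⟨c, n, hc0, rfl, hc⟩ := exists_chain h
    obtain ⟨y, hy⟩ := hmax c n ⟨hc0, hc⟩ hstuck
    exact hlabel hy.1

theorem exists_mem_compute_of_final (hx : x ∈ N.compute.dom)
    (h : Relation.ReflTransGen Step (N.init x) κ) (hκ : κ.label = N.final) :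
    ∃ y ∈ N.compute x, κ.tape 0 0 = .inl y := by
  obtain ⟨x₀, hmax, -⟩ := hx
  obtain ⟨c, n, hc0, rfl, hc⟩ := exists_chain h
  obtain ⟨y, hy⟩ := hmax.2 c n ⟨hc0, hc⟩ fun κ' hs => hs.1 hκ
  exact ⟨y, ⟨hmax, c, n, ⟨hc0, hc⟩, hy⟩, hy.2⟩

end Terminates

section Applies

variable {s L : ℕ} {Z : Fin (L + 1) → MRSet.{u} s} {N : GTM s (fun i => (Z i).carrier)}
  {S₃ S₄ : MRSet.{u} s} {g : MultiFun S₃ S₄}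

theorem AppliesAtMostOnce.not_labelApplies (h : N.AppliesAtMostOnce g) {l l' : N.Label}
    (hl : Relation.ReflTransGen N.Edge N.start l) (hg : N.LabelApplies g l)
    (hl' : Relation.TransGen N.Edge l l') : ¬ N.LabelApplies g l' := by
  intro hg'
  obtain ⟨π, n, hπ0, rfl, hπ⟩ := exists_chain hl
  obtain ⟨π', n', hn, heq, rfl, hπ'⟩ := exists_chain_extending hπ hl'
  have hpath : N.IsPath π' n' := ⟨(heq 0 n.zero_le).trans hπ0, hπ'⟩
  exact hn.ne (h π' n' hpath n hn.le n' le_rfl (by rwa [heq n le_rfl]) hg')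

theorem AlwaysApplies.not_accepts {D : Set (∀ j, Z (N.inputTape j))} (h : N.AlwaysApplies g D)
    {x : ∀ j, Z (N.inputTape j)} (hx : x ∈ D) {κ : N.Config} (hκ : Relation.ReflTransGen
      (fun a b : N.Config => Step a b ∧ ¬ N.LabelApplies g a.label) (N.init x) κ) (y : Z 0) :
    ¬ κ.Accepts y := by
  intro hy
  obtain ⟨c, n, hc0, rfl, hc⟩ := exists_chain hκ
  obtain ⟨i, hi, hg⟩ := h x hx c n ⟨hc0, fun i hi => (hc i hi).1⟩ ⟨y, hy⟩
  rcases hi.lt_or_eq with hlt | rfl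
  · exact (hc i hlt).2 hg
  · exact hg.1 hy.1

end Applies

end GTM

/-! ### The simulation -/

section Simulation

variable {s L : ℕ} {Z : Fin (L + 1) → MRSet.{u} s} {S₃ S₄ : MRSet.{u} s}

/-- The instruction `I` simulates the statement; an assignment applying `g` is simulated by an
oracle call, every other assignment and every test by a procedure computing a realizer. -/
inductive Implements (g : MultiFun S₃ S₄) {Γ Λ : Type} :
    Stmt s (fun i => (Z i).carrier) Γ Λ → Instr s L Γ Λ → Prop
  | right (i l) : Implements g (.right i l) (.right i l)
  | left (i l) : Implements g (.left i l) (.left i l)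
  | write (i a l) : Implements g (.write i a l) (.write i a l)
  | ifSymbol (i a l l') : Implements g (.ifSymbol i a l l') (.ifSymbol i a l l')
  | assign (i) {n : ℕ} (src : Fin n → Fin (L + 1)) (c l) {F out} (hF : ComputesSeq out F)
      (hr : (⟨_, fun j => Z (src j), Z i, c⟩ : MFun.{u} s).RealizedBy F)
      (hg : (⟨_, fun j => Z (src j), Z i, c⟩ : MFun.{u} s) ≠ unary g) :
      Implements g (.assign i src c l) (.assign i src out hF.1 l)
  | test {n : ℕ} (src : Fin n → Fin (L + 1)) (t h l l') {F out} (hF : ComputesValue out F)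
      (hr : TestRealizedBy (fun j => Z (src j)) t F) :
      Implements g (.test src t h l l') (.test src out hF.1 l l')
  | call (i) {n : ℕ} (src : Fin n → Fin (L + 1)) (c l) (j : Fin n)
      (hg : (⟨_, fun j => Z (src j), Z i, c⟩ : MFun.{u} s) = unary g) :
      Implements g (.assign i src c l) (.call (src j) i l)

/-- The contents `x m` of a cell converge to the content `y` of a cell of a generalized Turing
machine, where an element of `S` is represented by its names. -/
def CellTracks {Γ : Type} (S : MRSet.{u} s) (x : ℕ → Word s ⊕ Γ) (y : S.carrier ⊕ Γ) : Prop :=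
  match y with
  | .inl z => ∃ q, z ∈ S.rep q ∧ ConvergesTo (fun m => cellWord (x m)) q
  | .inr a => ∀ᶠ m in atTop, x m = .inr a

section CellTracks

variable {Γ : Type} {S : MRSet.{u} s} {x x' : ℕ → Word s ⊕ Γ} {y : S.carrier ⊕ Γ}

theorem CellTracks.congr (h : CellTracks S x y) (hx : ∀ᶠ m in atTop, x m = x' m) :
    CellTracks S x' y := by
  cases y with
  | inl z =>
    obtain ⟨q, hz, hq⟩ := h
    exact ⟨q, hz, hq.congr (hx.mono fun m hm => by rw [hm])⟩
  | inr a => filter_upwards [h, hx] with m hm hm' using hm'.symm.trans hm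

theorem CellTracks.eventually_eq_inr_iff (h : CellTracks S x y) (a : Γ) :
    ∀ᶠ m in atTop, (x m = .inr a ↔ y = .inr a) := by
  cases y with
  | inl z =>
    obtain ⟨q, -, hq⟩ := h
    filter_upwards [hq 1] with m hm
    refine iff_of_false (fun hx => ?_) Sum.inl_ne_inr
    simpa [hx, cellWord] using hm.length_le
  | inr b => filter_upwards [h] with m hm using by rw [hm, Sum.inr.injEq, Sum.inr.injEq]

end CellTracks

variable {N : GTM s (fun i => (Z i).carrier)}

/-- The tapes `T m` of a machine on words converge to the tapes of the configuration `κ`. -/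
def Tracks (T : ℕ → Tapes s L N.Γ) (κ : N.Config) : Prop :=
  (∀ᶠ m in atTop, (T m).1 = κ.head) ∧
    ∀ i z, CellTracks (Z i) (fun m => (T m).lookup N.blank i z) (κ.tape i z)

section Tracks

variable {T : ℕ → Tapes s L N.Γ} {κ : N.Config}

theorem Tracks.scan (h : Tracks T κ) (i : Fin (L + 1)) :
    CellTracks (Z i) (fun m => (T m).scan N.blank i) (κ.scan i) :=
  (h.2 i (κ.head i)).congr (h.1.mono fun m hm => by rw [Tapes.scan, hm])

theorem Tracks.exists_convergesTo_word (h : Tracks T κ) {i : Fin (L + 1)} {z : Z i}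
    (hz : κ.scan i = .inl z) :
    ∃ q, z ∈ (Z i).rep q ∧ ConvergesTo (fun m => (T m).word N.blank i) q := by
  have hscan := h.scan i
  rwa [hz] at hscan

theorem Tracks.move (h : Tracks T κ) (i : Fin (L + 1)) (d : ℤ) :
    Tracks (fun m => (T m).move i d) (κ.move i d) :=
  ⟨h.1.mono fun m hm => by simp only [Tapes.move, GTM.Config.move, hm], h.2⟩

theorem Tracks.put (h : Tracks T κ) (i : Fin (L + 1)) {x : ℕ → Word s ⊕ N.Γ}
    {y : (Z i).carrier ⊕ N.Γ} (hxy : CellTracks (Z i) x y) :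
    Tracks (fun m => (T m).put i (x m)) (κ.put i y) := by
  refine ⟨h.1, fun j z => ?_⟩
  by_cases hjz : (i, κ.head i) = (j, z)
  · obtain ⟨rfl, rfl⟩ := Prod.mk.inj hjz
    simp only [GTM.Config.put, Function.update_self]
    exact hxy.congr (h.1.mono fun m hm => by rw [Tapes.lookup_put, hm, if_pos rfl])
  · have htape : (κ.put i y).tape j z = κ.tape j z := by
      rcases eq_or_ne j i with rfl | hj
      · have hz : z ≠ κ.head j := fun hz => hjz (by rw [hz])
        simp only [GTM.Config.put, Function.update_self, Function.update_of_ne hz]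
      · simp only [GTM.Config.put, Function.update_of_ne hj]
    rw [htape]
    exact (h.2 j z).congr (h.1.mono fun m hm => by rw [Tapes.lookup_put, hm, if_neg hjz])

end Tracks

variable {g : MultiFun S₃ S₄} {T : ℕ → Tapes s L N.Γ} {κ : N.Config}

theorem Tracks.exists_exec (hT : Tracks T κ) {S : Stmt s (fun i => (Z i).carrier) N.Γ N.Label}
    {I : Instr s L N.Γ N.Label} (hS : Implements g S I) (hg : ¬ S.Applies g)
    (hex : ∃ κ', GTM.Exec κ κ' S) :
    ∃ κ' T', GTM.Exec κ κ' S ∧ Tracks T' κ' ∧ ∀ ρ : ℕ → Option (Word s),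
      ∀ᶠ m in atTop, I.exec N.blank m (ρ m) (κ.label, T m) = some (κ'.label, T' m) := by
  obtain ⟨κ₀, hκ₀⟩ := hex
  cases hS with
  | right i l => exact ⟨_, _, rfl, hT.move i 1, fun _ => .of_forall fun _ => rfl⟩
  | left i l => exact ⟨_, _, rfl, hT.move i (-1), fun _ => .of_forall fun _ => rfl⟩
  | write i a l =>
    exact ⟨_, _, rfl, hT.put i (y := .inr a) (.of_forall fun _ => rfl),
      fun _ => .of_forall fun _ => rfl⟩
  | ifSymbol i a l l' =>
    refine ⟨κ₀, T, hκ₀, ?_, fun ρ => ?_⟩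
    · rcases hκ₀ with ⟨-, rfl⟩ | ⟨-, rfl⟩ <;> exact hT
    · filter_upwards [(hT.scan i).eventually_eq_inr_iff a] with m hm
      rcases hκ₀ with ⟨h, rfl⟩ | ⟨h, rfl⟩
      · simp only [Instr.exec, hm, h, if_true, GTM.Config.goto]
      · simp only [Instr.exec, hm, h, if_false, GTM.Config.goto]
  | @assign i n src c l F out hF hr =>
    obtain ⟨v, hv, x, hx, -⟩ := hκ₀
    choose q hq hw using fun j => hT.exists_convergesTo_word (hv j)
    obtain ⟨hd, hval⟩ := hr q v hq ⟨x, hx⟩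
    obtain ⟨z, hz, hzq⟩ := hval _ (Part.get_mem hd)
    let w (m : ℕ) : Word s := evalAt out m fun j => (T m).word N.blank (src j)
    exact ⟨_, _, ⟨v, hv, z, hz, rfl⟩, hT.put i (x := fun m => .inl (w m)) (y := .inl z)
      ⟨_, hzq, hF.convergesTo_evalAt hw (Part.get_mem hd)⟩,
      fun _ => .of_forall fun _ => rfl⟩
  | test src t h l l' hF hr =>
    refine ⟨κ₀, T, hκ₀, ?_, fun ρ => ?_⟩
    · obtain ⟨v, -, ⟨-, rfl⟩ | ⟨-, rfl⟩⟩ := hκ₀ <;> exact hT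
    · obtain ⟨v, hv, hκ₀⟩ := hκ₀
      choose q hq hw using fun j => hT.exists_convergesTo_word (hv j)
      rcases hκ₀ with ⟨ht, rfl⟩ | ⟨ht, rfl⟩ <;>
      · filter_upwards [hF.eventually_evalAt_eq hw (hr q v hq _ ht)] with m hm
        simp [Instr.exec, hm, GTM.Config.goto]
  | call i src c l j h => exact absurd h hg

/-- The machine on words with the program `prog` on the tapes of `N`. -/
def GTM.simulator (N : GTM s (fun i => (Z i).carrier)) (prog : N.Label → Instr s L N.Γ N.Label)
    (input : Fin (L + 1)) : OracleMachine s L N.Γ N.Label :=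
  ⟨N.blank, N.start, input, prog⟩

/-- The program `prog` simulates the program of `N` with an oracle for `g`. -/
structure Simulates (g : MultiFun S₃ S₄) (N : GTM s (fun i => (Z i).carrier))
    (prog : N.Label → Instr s L N.Γ N.Label) : Prop where
  implements : ∀ l h, Implements g (N.stm l h) (prog l)
  halt : prog N.final = .halt

theorem exists_mem_of_eq_unary {n : ℕ} {A : Fin n → MRSet.{u} s} {B : MRSet.{u} s}
    {c : MultiFun (∀ j, A j) B} (e : (⟨n, A, B, c⟩ : MFun.{u} s) = unary g)
    {h : (Fin 1 → Seq s) →. Seq s} (hh : (unary g).RealizedBy h) (j : Fin n) {v : ∀ j, A j}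
    (hv : (c v).Nonempty) {q : Seq s} (hq : v j ∈ (A j).rep q) :
    ∃ r ∈ h ![q], ∃ z ∈ c v, z ∈ B.rep r := by
  cases e
  obtain rfl : j = (0 : Fin 1) := Subsingleton.elim (α := Fin 1) _ _
  have hname (j : Fin 1) : v j ∈ S₃.rep (![q] j) := by rwa [Subsingleton.elim j 0]
  obtain ⟨hd, hval⟩ := hh ![q] v hname hv
  exact ⟨_, Part.get_mem hd, hval _ (Part.get_mem hd)⟩

theorem realizedBy_unary_of_eq {n : ℕ} {A : Fin n → MRSet.{u} s} {B : MRSet.{u} s}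
    {c : MultiFun (∀ j, A j) B} (e : (⟨n, A, B, c⟩ : MFun.{u} s) = unary g)
    {F : (Fin 1 → Seq s) →. Seq s}
    (hF : ∀ (p : Seq s) (x : ∀ j, A j), (∀ j, x j ∈ (A j).rep p) → x ∈ c.dom →
      ∃ q ∈ F ![p], ∃ y ∈ c x, y ∈ B.rep q) : (unary g).RealizedBy F := by
  cases e
  intro (p : Fin 1 → Seq s) x hx hxd
  obtain ⟨q, hq, hy⟩ := hF (p 0) x (fun (j : Fin 1) => by
    obtain rfl : j = 0 := Subsingleton.elim _ _
    exact hx (0 : Fin 1)) hxd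
  have hp : (![p 0] : Fin 1 → Seq s) = p := by
    funext j
    rw [Subsingleton.elim j 0, Matrix.cons_val_zero]
  rw [hp] at hq
  exact ⟨Part.dom_iff_mem.2 ⟨q, hq⟩, fun q' hq' => Part.mem_unique hq' hq ▸ hy⟩

theorem tracks_init (hk : N.k = 1) (prog : N.Label → Instr s L N.Γ N.Label) (j : Fin N.k)
    {x : ∀ j, Z (N.inputTape j)} {p : Seq s} (hp : ∀ j, x j ∈ (Z (N.inputTape j)).rep p) :
    Tracks (fun m => ((N.simulator prog (N.inputTape j)).init (p.pre m)).2) (N.init x) := by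
  refine ⟨.of_forall fun _ => rfl, fun i z => ?_⟩
  have hlookup (m : ℕ) :
      ((N.simulator prog (N.inputTape j)).init (p.pre m)).2.lookup N.blank i z =
        if (N.inputTape j, 0) = (i, z) then .inl (p.pre m) else .inr N.blank := rfl
  by_cases hiz : (N.inputTape j, 0) = (i, z)
  · obtain ⟨rfl, rfl⟩ := Prod.mk.inj hiz
    have htape : (N.init x).tape (N.inputTape j) 0 = .inl (x j) := dif_pos ⟨rfl, j.2⟩
    rw [htape]
    refine ⟨p, hp j, (convergesTo_pre p).congr (.of_forall fun m => ?_)⟩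
    exact congrArg cellWord ((hlookup m).trans (if_pos rfl)).symm
  · have htape : (N.init x).tape i z = .inr N.blank := by
      cases i using Fin.cases with
      | zero => rfl
      | succ i =>
        refine dif_neg fun ⟨hz, hi⟩ => hiz ?_
        replace hi : i.val < N.k := hi
        have hj : j.val < N.k := j.2
        have hij : N.inputTape j = i.succ :=
          congrArg Fin.succ (Fin.ext (show j.val = i.val by omega))
        rw [hij, hz]
    rw [htape]
    exact .of_forall fun m => (hlookup m).trans (if_neg hiz)

namespace Simulates

variable {prog : N.Label → Instr s L N.Γ N.Label} (hprog : Simulates g N prog)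
include hprog

theorem exists_leads (hκ : GTM.Terminates κ) (hT : Tracks T κ) (input : Fin (L + 1)) :
    ∃ κ' T', Relation.ReflTransGen
        (fun a b : N.Config => GTM.Step a b ∧ ¬ N.LabelApplies g a.label) κ κ' ∧
      Tracks T' κ' ∧ (κ'.label = N.final ∨ N.LabelApplies g κ'.label) ∧
      ∀ ρ, (N.simulator prog input).Leads ρ (fun m => (κ.label, T m))
        fun m => (κ'.label, T' m) := by
  induction hκ generalizing T with
  | intro κ hstep _ ih =>
    by_cases hend : κ.label = N.final ∨ N.LabelApplies g κ.label
    · exact ⟨κ, T, .refl, hT, hend, fun ρ => .refl ρ _⟩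
    · obtain ⟨hfin, hg⟩ := not_or.1 hend
      obtain ⟨κ₀, _, hκ₀⟩ := hstep hfin
      obtain ⟨κ₁, T₁, hexec, hT₁, hI⟩ :=
        hT.exists_exec (hprog.implements κ.label hfin) (fun h => hg ⟨hfin, h⟩) ⟨κ₀, hκ₀⟩
      obtain ⟨κ', T', hsteps, hT', hend', hleads⟩ := ih κ₁ ⟨hfin, hexec⟩ hT₁
      exact ⟨κ', T', hsteps.head ⟨⟨hfin, hexec⟩, hg⟩, hT', hend', fun ρ =>
        .trans (.of_step (hI ρ)) (hleads ρ)⟩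

theorem exists_call (hT : Tracks T κ) (hg : N.LabelApplies g κ.label)
    (hstep : ∃ κ', GTM.Step κ κ') {h : (Fin 1 → Seq s) →. Seq s} (hh : (unary g).RealizedBy h)
    (input : Fin (L + 1)) :
    ∃ i₁ i l q r, prog κ.label = .call i₁ i l ∧
      ConvergesTo (fun m => (T m).word N.blank i₁) q ∧ r ∈ h ![q] ∧
      ∃ κ' T', GTM.Step κ κ' ∧ Tracks T' κ' ∧
        (N.simulator prog input).Leads (fun m => some (r.pre m)) (fun m => (κ.label, T m))
          fun m => (κ'.label, T' m) := by
  obtain ⟨hfin, hg⟩ := hg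
  obtain ⟨κ₀, _, hκ₀⟩ := hstep
  have himp := hprog.implements κ.label hfin
  generalize hS : N.stm κ.label hfin = S at himp hg hκ₀
  generalize hI : prog κ.label = I at himp
  cases himp with
  | assign i src c l _ _ hne => exact absurd hg hne
  | call i src c l j hc =>
    obtain ⟨v, hv, z₀, hz₀, -⟩ := hκ₀
    obtain ⟨q, hvq, hq⟩ := hT.exists_convergesTo_word (hv j)
    obtain ⟨r, hr, z, hz, hzr⟩ := exists_mem_of_eq_unary hc hh j ⟨z₀, hz₀⟩ hvq
    refine ⟨_, i, l, q, r, rfl, hq, hr, (κ.put i (.inl z)).goto l, _, ⟨hfin, ?_⟩,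
      hT.put i (x := fun m => .inl (r.pre m)) (y := .inl z) ⟨r, hzr, convergesTo_pre r⟩,
      .of_step (.of_forall fun m => ?_)⟩
    · rw [hS]
      exact ⟨v, hv, z, hz, rfl⟩
    · simp only [OracleMachine.step, GTM.simulator, hI]
      rfl
  | _ => exact hg.elim

theorem exists_mem_resultFun (hT : Tracks T κ) {x : ∀ j, Z (N.inputTape j)}
    (hx : x ∈ N.compute.dom) (hκ : Relation.ReflTransGen GTM.Step (N.init x) κ)
    (hfin : κ.label = N.final) {input : Fin (L + 1)} {p r : Seq s}
    (h : (N.simulator prog input).Leads (fun m => some (r.pre m))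
      (fun m => (N.simulator prog input).init (p.pre m)) fun m => (κ.label, T m)) :
    ∃ q ∈ (N.simulator prog input).resultFun ![p, r], ∃ y ∈ N.compute x, y ∈ (Z 0).rep q := by
  obtain ⟨y, hy, htape⟩ := GTM.exists_mem_compute_of_final hx hκ hfin
  have hcell := hT.2 0 0
  rw [htape] at hcell
  obtain ⟨q, hyq, hq⟩ := hcell
  exact ⟨q, h.mem_resultFun (hfin ▸ hprog.halt) hq, y, hy, hyq⟩

theorem exists_question_and_result (honce : N.AppliesAtMostOnce g) (hk : N.k = 1)
    (j : Fin N.k) {D : Set (∀ j, Z (N.inputTape j))} {p₀ : Seq s}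
    (hp₀ : (∃ y ∈ g.dom, y ∈ S₃.rep p₀) ∨ N.AlwaysApplies g D) {x : ∀ j, Z (N.inputTape j)}
    (hx : x ∈ N.compute.dom) (hxD : x ∈ D) {p : Seq s}
    (hp : ∀ j, x j ∈ (Z (N.inputTape j)).rep p) {h : (Fin 1 → Seq s) →. Seq s}
    (hh : (unary g).RealizedBy h) :
    ∃ q ∈ (N.simulator prog (N.inputTape j)).questionFun p₀ ![p], ∃ r ∈ h ![q],
      ∃ q' ∈ (N.simulator prog (N.inputTape j)).resultFun ![p, r],
        ∃ y ∈ N.compute x, y ∈ (Z 0).rep q' := by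
  have hterm := GTM.terminates_of_mem_dom hx
  obtain ⟨κ₁, T₁, hsteps₁, hT₁, hend₁, hleads₁⟩ :=
    hprog.exists_leads hterm (tracks_init hk prog j hp) (N.inputTape j)
  have hreach₁ : Relation.ReflTransGen GTM.Step (N.init x) κ₁ :=
    hsteps₁.lift id fun _ _ h => h.1
  rcases hend₁ with hfin | hg
  · obtain ⟨y₀, hy₀, hname⟩ := hp₀.resolve_right fun hall => by
      obtain ⟨y, -, htape⟩ := GTM.exists_mem_compute_of_final hx hreach₁ hfin
      exact hall.not_accepts hxD hsteps₁ y ⟨hfin, htape⟩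
    obtain ⟨hd, -⟩ := hh ![p₀] (fun _ => y₀) (fun j : Fin 1 => by rwa [Subsingleton.elim j 0]) hy₀
    exact ⟨p₀, (hleads₁ _).mem_questionFun_of_halt (hfin ▸ hprog.halt), _, Part.get_mem hd,
      hprog.exists_mem_resultFun hT₁ hx hreach₁ hfin (hleads₁ _)⟩
  · obtain ⟨i₁, i, l, q, r, hcall, hq, hr, κ₂, T₂, hstep, hT₂, hleads₂⟩ := hprog.exists_call hT₁ hg
      ((hterm.of_reflTransGen hreach₁).exists_step hg.1) hh (N.inputTape j)
    obtain ⟨κ₃, T₃, hsteps₃, hT₃, hend₃, hleads₃⟩ := hprog.exists_leads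
      (hterm.of_reflTransGen (hreach₁.tail hstep)) hT₂ (N.inputTape j)
    have hreach₃ : Relation.ReflTransGen GTM.Step κ₂ κ₃ :=
      hsteps₃.lift id fun _ _ h => h.1
    have hfin₃ : κ₃.label = N.final := hend₃.resolve_right <| honce.not_labelApplies
      (hreach₁.lift GTM.Config.label fun _ _ => GTM.Step.edge) hg
      (.head' hstep.edge (hreach₃.lift GTM.Config.label fun _ _ => GTM.Step.edge))
    exact ⟨q, (hleads₁ _).mem_questionFun_of_call hcall hq, r, hr, hprog.exists_mem_resultFun hT₃ hx
      ((hreach₁.tail hstep).trans hreach₃) hfin₃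
      (((hleads₁ _).trans hleads₂).trans (hleads₃ _))⟩

theorem isReduction (honce : N.AppliesAtMostOnce g) {S₁ S₂ : MRSet.{u} s} {f : MultiFun S₁ S₂}
    {f₀ : MultiFun (∀ j, Z (N.inputTape j)) (Z 0)}
    (hf₀ : (⟨N.k, fun j => Z (N.inputTape j), Z 0, f₀⟩ : MFun.{u} s) = unary f)
    (hext : N.compute.Extends f₀) (j : Fin N.k) {p₀ : Seq s}
    (hp₀ : (∃ y ∈ g.dom, y ∈ S₃.rep p₀) ∨ N.AlwaysApplies g f₀.dom) :
    IsReduction (N.simulator prog (N.inputTape j)).resultFun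
      ((N.simulator prog (N.inputTape j)).questionFun p₀) f g := by
  refine fun h hh => realizedBy_unary_of_eq hf₀ fun p x hp hx => ?_
  obtain ⟨q, hq, r, hr, q', hq', y, hy, hyq⟩ := hprog.exists_question_and_result honce
    (congrArg MFun.arity hf₀) j hp₀ (hext.1 hx) hx hp hh
  exact ⟨q', Part.mem_bind hq (Part.mem_bind hr hq'), y, hext.2 x hx hy, hyq⟩

end Simulates

end Simulation

/-! ### The existence of a simulating program -/

section Program

variable {s L : ℕ} {Z : Fin (L + 1) → MRSet.{u} s} {S₃ S₄ : MRSet.{u} s}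

/-- A procedure with the property `P` computes a realizer of the multi-function `c`. -/
def MFun.HasProc
    (P : ∀ {n : ℕ} {σ : Type} [Primcodable σ], (ℕ → (Fin n → Word s) → σ) → Prop)
    (c : MFun.{u} s) : Prop :=
  ∃ F out, ComputesSeq out F ∧ c.RealizedBy F ∧ P out

/-- A procedure with the property `P` computes a realizer of the test `t`. -/
def TestHasProc (P : ∀ {n : ℕ} {σ : Type} [Primcodable σ], (ℕ → (Fin n → Word s) → σ) → Prop)
    {n : ℕ} (S : Fin n → MRSet.{u} s) (t : (∀ j, S j) →. Word s) : Prop :=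
  ∃ F out, ComputesValue out F ∧ TestRealizedBy S t F ∧ P out

theorem MFun.IsComputable.hasProc {c : MFun.{u} s} (h : c.IsComputable) :
    c.HasProc Computable₂ := by
  obtain ⟨F, ⟨out, hout, hF⟩, hr⟩ := h
  exact ⟨F, out, hF, hr, hout⟩

theorem MFun.IsContinuous.hasProc {c : MFun.{u} s} (h : c.IsContinuous) :
    c.HasProc fun _ => True := by
  obtain ⟨F, hF, hr⟩ := h
  obtain ⟨out, hout⟩ := hF.exists_computesSeq
  exact ⟨F, out, hout, hr, trivial⟩

theorem TestComputable.hasProc {n : ℕ} {S : Fin n → MRSet.{u} s} {t : (∀ j, S j) →. Word s}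
    (h : TestComputable S t) : TestHasProc Computable₂ S t := by
  obtain ⟨F, ⟨out, hout, hF⟩, hr⟩ := h
  exact ⟨F, out, hF, hr, hout⟩

theorem TestContinuous.hasProc {n : ℕ} {S : Fin n → MRSet.{u} s} {t : (∀ j, S j) →. Word s}
    (h : TestContinuous S t) : TestHasProc (fun _ => True) S t := by
  obtain ⟨F, hF, hr⟩ := h
  exact ⟨F, _, computesValue_firstForcedValue hF, hr, trivial⟩

theorem Stmt.AssignSat.imp {Γ Λ : Type} {P Q : MFun.{u} s → Prop} (h : ∀ c, P c → Q c)
    {S : Stmt s (fun i => (Z i).carrier) Γ Λ} (hS : S.AssignSat P) : S.AssignSat Q := by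
  cases S with
  | assign => exact h _ hS
  | _ => trivial

theorem Stmt.TestSat.imp {Γ Λ : Type}
    {P Q : ∀ {n : ℕ} (S : Fin n → MRSet.{u} s), ((∀ j, S j) →. Word s) → Prop}
    (h : ∀ {n : ℕ} (S : Fin n → MRSet.{u} s) t, P S t → Q S t)
    {S : Stmt s (fun i => (Z i).carrier) Γ Λ} (hS : S.TestSat P) : S.TestSat Q := by
  cases S with
  | test => exact h _ _ hS
  | _ => trivial

variable {P : ∀ {n : ℕ} {σ : Type} [Primcodable σ], (ℕ → (Fin n → Word s) → σ) → Prop}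
  {g : MultiFun S₃ S₄}

theorem exists_implements {Γ Λ : Type} {S : Stmt s (fun i => (Z i).carrier) Γ Λ}
    (hT : S.TestSat (TestHasProc P)) (hA : S.AssignSat (MFun.HasProc P) ∨ S.Applies g) :
    ∃ I, Implements g S I ∧ I.ProcSat P := by
  cases S with
  | right i l => exact ⟨_, .right i l, trivial⟩
  | left i l => exact ⟨_, .left i l, trivial⟩
  | write i a l => exact ⟨_, .write i a l, trivial⟩
  | ifSymbol i a l l' => exact ⟨_, .ifSymbol i a l l', trivial⟩
  | @assign i n src c l =>
    by_cases hg : (⟨_, fun j => Z (src j), Z i, c⟩ : MFun.{u} s) = unary g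
    · have hn : n = 1 := congrArg MFun.arity hg
      exact ⟨_, .call i src c l ⟨0, by omega⟩ hg, trivial⟩
    · obtain ⟨F, out, hF, hr, hP⟩ := hA.resolve_right hg
      exact ⟨_, .assign i src c l hF hr hg, hP⟩
  | test src t h l l' =>
    obtain ⟨F, out, hF, hr, hP⟩ := hT
    exact ⟨_, .test src t h l l' hF hr, hP⟩

theorem exists_simulates {N : GTM s (fun i => (Z i).carrier)}
    (hT : ∀ l h, (N.stm l h).TestSat (TestHasProc P))
    (hA : ∀ l h, (N.stm l h).AssignSat (MFun.HasProc P) ∨ (N.stm l h).Applies g) :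
    ∃ prog, Simulates g N prog ∧ ∀ l, (prog l).ProcSat P := by
  have hex (l : N.Label) : ∃ I : Instr s L N.Γ N.Label,
      (∀ h, Implements g (N.stm l h) I) ∧ (l = N.final → I = .halt) ∧ I.ProcSat P := by
    by_cases hl : l = N.final
    · exact ⟨.halt, fun h => absurd hl h, fun _ => rfl, trivial⟩
    · obtain ⟨I, hI, hP⟩ := exists_implements (hT l hl) (hA l hl)
      exact ⟨I, fun _ => hI, fun h => absurd h hl, hP⟩
  choose prog himp hhalt hP using hex
  exact ⟨prog, ⟨himp, hhalt _ rfl⟩, hP⟩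

theorem dom_nonempty_of_not_isContinuous (h : ¬ (unary g).IsContinuous) : g.dom.Nonempty := by
  by_contra hemp
  refine h ⟨fun _ => Part.none, ?_, fun p y _ hy => absurd ⟨_, hy⟩ hemp⟩
  exact continuous_iff_continuousAt.2 fun x => absurd x.2 id

variable {S₁ S₂ : MRSet.{u} s} {f : MultiFun S₁ S₂} {N : GTM s (fun i => (Z i).carrier)}
  {f₀ : MultiFun (∀ j, Z (N.inputTape j)) (Z 0)}

theorem weihrauchLE_of_appliesAtMostOnce
    (hf₀ : (⟨N.k, fun j => Z (N.inputTape j), Z 0, f₀⟩ : MFun.{u} s) = unary f)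
    (honce : N.AppliesAtMostOnce g) (hext : N.compute.Extends f₀) (hT : N.TestsComputable)
    (hA : N.AssignsComputableOr g) (hp : HasComputablePoint g ∨ N.AlwaysApplies g f₀.dom) :
    WeihrauchLE f g := by
  obtain ⟨prog, hprog, hcomp⟩ := exists_simulates (P := Computable₂)
    (fun l h => (hT l h).imp fun _ _ ht => ht.hasProc)
    (fun l h => (hA l h).imp_left (.imp fun _ hc => hc.hasProc))
  obtain ⟨p₀, hp₀, hname⟩ : ∃ p₀ : Seq s, Computable p₀ ∧
      ((∃ y ∈ g.dom, y ∈ S₃.rep p₀) ∨ N.AlwaysApplies g f₀.dom) := by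
    rcases hp with ⟨y, hy, p, hp, hyp⟩ | hall
    · exact ⟨p, hp, .inl ⟨y, hy, hyp⟩⟩
    · exact ⟨fun _ => 0, Computable.const 0, .inr hall⟩
  have hk : N.k = 1 := congrArg MFun.arity hf₀
  let j : Fin N.k := ⟨0, by omega⟩
  let M := N.simulator prog (N.inputTape j)
  have := N.finite_Γ
  have := N.finite_label
  exact ⟨M.resultFun, M.questionFun p₀,
    ⟨_, M.computable_resultProc hcomp, computesSeq_limFun M.isMono_resultProc⟩,
    ⟨_, M.computable_questionProc hcomp hp₀, computesSeq_limFun (M.isMono_questionProc p₀)⟩,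
    hprog.isReduction honce hf₀ hext j hname⟩

theorem contWeihrauchLE_of_appliesAtMostOnce
    (hf₀ : (⟨N.k, fun j => Z (N.inputTape j), Z 0, f₀⟩ : MFun.{u} s) = unary f)
    (honce : N.AppliesAtMostOnce g) (hext : N.compute.Extends f₀) (hT : N.TestsContinuous)
    (hA : N.AssignsContinuousOr g) (hp : g.dom.Nonempty ∨ N.AlwaysApplies g f₀.dom) :
    ContWeihrauchLE f g := by
  obtain ⟨prog, hprog, -⟩ := exists_simulates (P := fun _ => True)
    (fun l h => (hT l h).imp fun _ _ ht => ht.hasProc)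
    (fun l h => (hA l h).imp_left (.imp fun _ hc => hc.hasProc))
  obtain ⟨p₀, hname⟩ : ∃ p₀, (∃ y ∈ g.dom, y ∈ S₃.rep p₀) ∨ N.AlwaysApplies g f₀.dom := by
    rcases hp with ⟨y, hy⟩ | hall
    · exact (S₃.surj y).imp fun _ hyp => .inl ⟨y, hy, hyp⟩
    · exact ⟨fun _ => 0, .inr hall⟩
  have hk : N.k = 1 := congrArg MFun.arity hf₀
  let j : Fin N.k := ⟨0, by omega⟩
  let M := N.simulator prog (N.inputTape j)
  exact ⟨M.resultFun, M.questionFun p₀,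
    (computesSeq_limFun M.isMono_resultProc).seqFunContinuous,
    (computesSeq_limFun (M.isMono_questionProc p₀)).seqFunContinuous,
    hprog.isReduction honce hf₀ hext j hname⟩

end Program

end GTMWeihrauch

theorem theoremt9_general {s L : ℕ} {S₁ S₂ S₃ S₄ : GTMWeihrauch.MRSet.{u} s}
    (f : GTMWeihrauch.MultiFun S₁ S₂) (g : GTMWeihrauch.MultiFun S₃ S₄)
    (Z : Fin (L + 1) → GTMWeihrauch.MRSet.{u} s)
    (N : GTMWeihrauch.GTM s (fun i => (Z i).carrier))
    (f₀ : GTMWeihrauch.MultiFun (∀ j : Fin N.k, Z (N.inputTape j)) (Z 0))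
    (hf₀ : (⟨N.k, fun j => Z (N.inputTape j), Z 0, f₀⟩ : GTMWeihrauch.MFun.{u} s) =
      GTMWeihrauch.unary f)
    (honce : N.AppliesAtMostOnce g)
    (hext : GTMWeihrauch.MultiFun.Extends N.compute f₀) :
    (N.TestsComputable → N.AssignsComputableOr g →
      (GTMWeihrauch.HasComputablePoint g ∨ N.AlwaysApplies g f₀.dom) →
      GTMWeihrauch.WeihrauchLE f g) ∧
    (N.TestsContinuous → N.AssignsContinuousOr g →
      (g.dom.Nonempty ∨ N.AlwaysApplies g f₀.dom) →
      GTMWeihrauch.ContWeihrauchLE f g) :=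
  ⟨GTMWeihrauch.weihrauchLE_of_appliesAtMostOnce hf₀ honce hext,
    GTMWeihrauch.contWeihrauchLE_of_appliesAtMostOnce hf₀ honce hext⟩

theorem theoremt9 {s L : ℕ} {S₁ S₂ S₃ S₄ : GTMWeihrauch.MRSet.{u} s}
    (f : GTMWeihrauch.MultiFun S₁ S₂) (g : GTMWeihrauch.MultiFun S₃ S₄)
    (Z : Fin (L + 1) → GTMWeihrauch.MRSet.{u} s)
    (N : GTMWeihrauch.GTM s (fun i => (Z i).carrier))
    -- `N` has one input tape, the sets of the input and output tapes are those of `f`,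
    -- and `f₀` is `f` as a multi-function on the sets of these tapes
    (f₀ : GTMWeihrauch.MultiFun (∀ j : Fin N.k, Z (N.inputTape j)) (Z 0))
    (hf₀ : (⟨N.k, fun j => Z (N.inputTape j), Z 0, f₀⟩ : GTMWeihrauch.MFun.{u} s) =
      GTMWeihrauch.unary f)
    (honce : N.AppliesAtMostOnce g)
    (hext : GTMWeihrauch.MultiFun.Extends N.compute f₀) :
    (¬ (GTMWeihrauch.unary g).IsComputable →
      N.TestsComputable → N.AssignsComputableOr g →
      (GTMWeihrauch.HasComputablePoint g ∨ N.AlwaysApplies g f₀.dom) →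
      GTMWeihrauch.WeihrauchLE f g) ∧
    (¬ (GTMWeihrauch.unary g).IsContinuous →
      N.TestsContinuous → N.AssignsContinuousOr g →
      GTMWeihrauch.ContWeihrauchLE f g) := by
  have h := theoremt9_general f g Z N f₀ hf₀ honce hext
  exact ⟨fun _ => h.1, fun hg hT hA =>
    h.2 hT hA (.inl (GTMWeihrauch.dom_nonempty_of_not_isContinuous hg))⟩
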